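/- Let $d\ge 1$ and $n\ge 0$ be integers and $\mu\in\mathbb R^d$. Put $\mu^*=\max_i\mu_i$ and $\Delta_i=\mu^*-\mu_i$. In round $t=1,\dots,n$ a learner chooses an arm $I_t\in\{1,\dots,d\}$ and receives a reward $X_t$ which, given $I_1,X_1,\dots,I_{t-1},X_{t-1},I_t$, has law $\mathcal N(\mu_{I_t},1)$. The regret is $R_\mu(n)=\mathbb E\bigl[\sum_{t=1}^n(\mu^*-\mu_{I_t})\bigr]$. Let $T_i(t)=\#\{s\le t: I_s=i\}$ and $\hat\mu_i(t)=\frac1{T_i(t)}\sum_{s\le t,\,I_s=i}X_s$. For $\nu\in\mathbb R$, $\sigma^2\ge 0$ and an integer $m\ge 1$ let $\theta\sim\mathcal N(\nu,\sigma^2)$ and, given $\theta$, let $Y_1,Y_2,\dots$ be independent with law $\mathcal N(\theta,1)$. The (finite-horizon) Gittins index is $$\gamma(\nu,\sigma^2,m)=\max\Bigl\{\gamma\in\mathbb R:\ \sup_{1\le\tau\le m}\mathbb E[(\theta-\gamma)\tau]\ge 0\Bigr\},$$ where the supremum is over stopping times $\tau$ of the filtration generated by $Y_1,Y_2,\dots$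 with $1\le\tau\le m$. The Gittins index strategy with a flat improper Gaussian prior and horizon $n$ chooses $I_t=t$ in the rounds $t\le\min\{d,n\}$, and in the rounds $d<t\le n$ it chooses $$I_t\in\operatorname*{arg\,max}_i\ \gamma\bigl(\hat\mu_i(t-1),\,T_i(t-1)^{-1},\,n-t+1\bigr),$$ with ties broken arbitrarily. There are universal constants $c,c'>0$ such that for all $d$, $n$ and $\mu$ the regret of this strategy satisfies $$R_\mu(n)\le c\sum_{i:\Delta_i>0}\Bigl(\frac{\log n}{\Delta_i}+\Delta_i\Bigr)\qquad\text{and}\qquad R_\mu(n)\le c'\Bigl(\sqrt{dn\log n}+\sum_{i=1}^d\Delta_i\Bigr)$$ (for $n=0$ both sides are read with $\log 0=0$). -/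

import Mathlib

open MeasureTheory ProbabilityTheory
open scoped NNReal

noncomputable section

namespace GittinsBandit

/-! ### The Gittins index of a Gaussian arm -/

/-- Sample space of a single arm: the random mean, and the noise of its successive plays. -/
abbrev ArmSpace : Type := ℝ × (ℕ → ℝ)

/-- The mean has law `N(ν, v)` (with variance `v`); the noise variables are i.i.d. `N(0, 1)` and
independent of the mean. -/
def armMeasure (ν : ℝ) (v : ℝ≥0) : Measure ArmSpace :=
  (gaussianReal ν v).prod (Measure.infinitePi fun _ : ℕ => gaussianReal 0 1)

/-- The observation `Y_{s+1}` of the arm. Conditionally on the mean `θ`, the observations are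
independent with law `N(θ, 1)`. -/
def armObs (s : ℕ) (ω : ArmSpace) : ℝ := ω.1 + ω.2 s

theorem measurable_armObs (s : ℕ) : Measurable (armObs s) :=
  measurable_fst.add ((measurable_pi_apply s).comp measurable_snd)

/-- The filtration generated by the observations: at time `t` it is `σ(Y_1, …, Y_t)`. -/
def armFiltration : Filtration ℕ (inferInstance : MeasurableSpace ArmSpace) where
  seq t := ⨆ s : ℕ, ⨆ _ : s < t, MeasurableSpace.comap (armObs s) inferInstance
  mono' _ _ h := iSup_mono fun _ => iSup_mono' fun hs => ⟨lt_of_lt_of_le hs h, le_rfl⟩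
  le' _ := iSup_le fun s => iSup_le fun _ => (measurable_armObs s).comap_le

/-- Stopping times `τ` of the filtration of the observations with `1 ≤ τ ≤ m`. -/
def IsArmStoppingTime (m : ℕ) (τ : ArmSpace → ℕ) : Prop :=
  IsStoppingTime armFiltration (fun ω => (τ ω : WithTop ℕ)) ∧ ∀ ω, 1 ≤ τ ω ∧ τ ω ≤ m

/-- `sup_{1 ≤ τ ≤ m} E[(μ - γ) τ]`, where `μ ∼ N(ν, v)` is the mean of the arm. For `m ≥ 1` this is
the supremum of a nonempty bounded set of real numbers. -/
def stoppingValue (ν : ℝ) (v : ℝ≥0) (m : ℕ) (γ : ℝ) : ℝ :=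
  sSup {x : ℝ | ∃ τ : ArmSpace → ℕ, IsArmStoppingTime m τ ∧
    x = ∫ ω, (ω.1 - γ) * (τ ω : ℝ) ∂(armMeasure ν v)}

/-- The Gittins index `γ(ν, v, m) = max {γ | sup_{1 ≤ τ ≤ m} E[(μ - γ) τ] ≥ 0}` of an arm with
posterior mean `ν`, posterior variance `v` and `m` remaining rounds. For `m ≥ 1` the maximum is
attained, since the stopping value is continuous and strictly decreasing in `γ`, with limits `±∞`. -/
def gittinsIndex (ν : ℝ) (v : ℝ≥0) (m : ℕ) : ℝ :=
  sSup {γ : ℝ | 0 ≤ stoppingValue ν v m γ}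

/-! ### The bandit

Rounds are numbered from `0`: the arm `I t` and the reward `X t` with `t < n` are those of the
`(t + 1)`-th round. -/

variable {Ω : Type*} {d : ℕ}

/-- The optimal mean `μ* = max_i μ_i`. -/
def optMean (μ : Fin d → ℝ) : ℝ := ⨆ i, μ i

/-- The gap `Δ_i = μ* - μ_i`. -/
def gap (μ : Fin d → ℝ) (i : Fin d) : ℝ := optMean μ - μ i

/-- The law of a reward, given the arm that is played. -/
def rewardKernel (μ : Fin d → ℝ) : Kernel (Fin d) ℝ :=
  Kernel.ofFunOfCountable fun i => gaussianReal (μ i) 1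

/-- The arms and rewards of the first `t` rounds. -/
def history (I : ℕ → Ω → Fin d) (X : ℕ → Ω → ℝ) (t : ℕ) (ω : Ω) : Fin t → Fin d × ℝ :=
  fun s => (I s ω, X s ω)

/-- `I` and `X` are the arms and rewards of a learner in the Gaussian bandit with means `μ` during
`n` rounds: given the past and the arm chosen in the current round, the reward has law
`N(μ_i, 1)`, where `i` is that arm. (The choice of the arm may use external randomness.) -/
structure IsInteraction [MeasurableSpace Ω] (P : Measure Ω) (μ : Fin d → ℝ) (n : ℕ)
    (I : ℕ → Ω → Fin d) (X : ℕ → Ω → ℝ) : Prop where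
  measurable_arm : ∀ t, Measurable (I t)
  measurable_reward : ∀ t, Measurable (X t)
  reward_law : ∀ t < n, HasCondDistrib (X t) (fun ω => (history I X t ω, I t ω))
    ((rewardKernel μ).prodMkLeft (Fin t → Fin d × ℝ)) P

/-- `T_i(t)`: the number of plays of arm `i` in the first `t` rounds. -/
def armCount (I : ℕ → Ω → Fin d) (i : Fin d) (t : ℕ) (ω : Ω) : ℕ :=
  ((Finset.range t).filter fun s => I s ω = i).card

/-- The empirical mean of arm `i` after the first `t` rounds (used only if `T_i(t) > 0`). -/
def empMean (I : ℕ → Ω → Fin d) (X : ℕ → Ω → ℝ) (i : Fin d) (t : ℕ) (ω : Ω) : ℝ :=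
  (∑ s ∈ (Finset.range t).filter (fun s => I s ω = i), X s ω) / (armCount I i t ω : ℝ)

/-- The index of arm `i` under the flat prior, when `t` of the `n` rounds have been played and
`n - t` rounds remain (the current one included). -/
def flatIndex (n : ℕ) (I : ℕ → Ω → Fin d) (X : ℕ → Ω → ℝ) (i : Fin d) (t : ℕ) (ω : Ω) : ℝ :=
  gittinsIndex (empMean I X i t ω) ((armCount I i t ω : ℝ≥0)⁻¹) (n - t)

/-- The arms are chosen by the Gittins index strategy with the flat Gaussian prior and horizon `n`:
each arm is played once in the first `d` rounds, in their order, and then in every round an arm of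
maximal index is played, ties being broken in any way. -/
def FollowsFlatGittins [MeasurableSpace Ω] (P : Measure Ω) (n : ℕ)
    (I : ℕ → Ω → Fin d) (X : ℕ → Ω → ℝ) : Prop :=
  ∀ᵐ ω ∂P, ∀ t < n,
    (t < d → (I t ω : ℕ) = t) ∧
    (d ≤ t → ∀ j, flatIndex n I X j t ω ≤ flatIndex n I X (I t ω) t ω)

/-- The expected regret `E[∑_{t=1}^n (μ* - μ_{I_t})]`. -/
def regret [MeasurableSpace Ω] (P : Measure Ω) (μ : Fin d → ℝ) (n : ℕ)
    (I : ℕ → Ω → Fin d) : ℝ :=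
  ∫ ω, ∑ t ∈ Finset.range n, (optMean μ - μ (I t ω)) ∂P

end GittinsBandit

end

/-! The regret is the sum over arms of gap times expected number of plays, so the heart of the
matter is a bound of order `1 + log n / Δ ^ 2` on the plays of an arm `i` with gap `Δ > 0`. If `i`
is played while the index of an optimal arm `j` is at least `μ j - Δ / 2`, then the index of `i` is
at least `μ i + Δ / 2`. The index exceeds the empirical mean by at most about `√(2 log n / T)`
(`gittinsIndex_le`), so either `i` has been played `O(log n / Δ ^ 2)` times or its empirical mean is
too large by `Δ / 4`. Such plays are few in mean (`index_dichotomy`, `playPotential_step`).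

The hard part is that the index of the optimal arm is rarely too small: with `m` rounds to go, it
lies below `μ j - ε` with probability `O(1 / (m * ε ^ 2))`. Summed over the rounds, this costs `∑ 1
/ (m * ε ^ 2)`, again of order `log n / Δ ^ 2`; a further logarithm in this probability would spoil
the result. A sharp lower bound on the index is needed (`exists_add_div_sqrt_le_gittinsIndex`). It
comes from a stopping rule that tests whether the mean exceeds `γ`: typical small means are rejected
quickly, and the rare large ones are played to the end. The index exceeds the empirical mean by `x /
√T` once `m` is a large multiple of `exp (x ^ 2 / 2) * x * (T + x ^ 2)`.

A small index at count `T` therefore means that a Gaussian walk has crossed a curved boundary. The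
counts are random and chosen adaptively, so all `T` must be treated together.
`exists_superharmonic_index` builds a superharmonic function of count and walk that is at least `1`
beyond the boundary: a weighted sum, over times `k`, of the probabilities that the walk is above a
slightly lower boundary at time `k`. A walk beyond the boundary at `T` stays above the lower one
with probability at least `1 / 2` at each time of a block of about `T / L` steps, and the weights of
a block add up to enough. Its initial value is a sum of Gaussian tails, which is `O(1 / (m * ε ^
2))`. Superharmonic functions of an arm's count and walk decrease in mean under every learner
(`IsInteraction.lintegral_superharmonic_le`).

The bound without gaps follows by splitting the arms at the gap `√(d * log n / n)`. -/

noncomputable section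

namespace GittinsBandit

/-! ### Estimates for Gaussian measures -/

lemma integral_exp_mul_gaussianReal (ν : ℝ) (v : ℝ≥0) (l : ℝ) :
    ∫ z, Real.exp (l * z) ∂gaussianReal ν v = Real.exp (ν * l + v * l ^ 2 / 2) := by
  have h := congrFun (mgf_id_gaussianReal (μ := ν) (v := v)) l
  simpa [mgf] using h

lemma lintegral_exp_mul_gaussianReal (ν : ℝ) (v : ℝ≥0) (l : ℝ) :
    ∫⁻ z, ENNReal.ofReal (Real.exp (l * z)) ∂gaussianReal ν v
      = ENNReal.ofReal (Real.exp (ν * l + v * l ^ 2 / 2)) := by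
  rw [← ofReal_integral_eq_lintegral_ofReal (integrable_exp_mul_gaussianReal l)
    (ae_of_all _ fun _ => (Real.exp_pos _).le), integral_exp_mul_gaussianReal]

/-- Chernoff's bound for the upper tail of a Gaussian measure. -/
lemma gaussianReal_real_Ici_le (ν : ℝ) {v : ℝ≥0} (hv : v ≠ 0) {r : ℝ} (hr : 0 ≤ r) :
    (gaussianReal ν v).real (Set.Ici (ν + r)) ≤ Real.exp (-r ^ 2 / (2 * v)) := by
  have hv' : (0 : ℝ) < v := by positivity
  have h := measure_ge_le_exp_mul_mgf (μ := gaussianReal ν v) (X := id) (ν + r)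
    (t := r / v) (by positivity) (integrable_exp_mul_gaussianReal _)
  rw [mgf_id_gaussianReal] at h
  refine h.trans (le_of_eq ?_)
  rw [← Real.exp_add]
  congr 1
  field_simp
  ring

/-- Mills' bound for the upper tail of a centred Gaussian measure. -/
lemma gaussianReal_real_Ici_le_div {v : ℝ≥0} (hv : v ≠ 0) {b : ℝ} (hb : 0 < b) :
    (gaussianReal 0 v).real (Set.Ici b) ≤ √v / b * Real.exp (-b ^ 2 / (2 * v)) := by
  have hv' : (0 : ℝ) < v := by positivity
  have hint : IntegrableOn (fun z : ℝ => Real.exp (-(b / v) * (z - b))) (Set.Ioi b) := by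
    have := integrableOn_exp_mul_Ioi (a := -(b / v)) (by simp; positivity) b
    have h2 := this.mul_const (Real.exp (b / v * b))
    refine h2.congr (ae_of_all _ fun z => ?_)
    simp only
    rw [← Real.exp_add]; ring_nf
  have hval : ∫ z in Set.Ioi b, Real.exp (-(b / v) * (z - b)) = v / b := by
    have := integral_exp_mul_Ioi (a := -(b / v)) (by simp; positivity) b
    have h3 : ∀ z, Real.exp (-(b / v) * (z - b))
        = Real.exp (-(b / v) * z) * Real.exp (b / v * b) := by
      intro z; rw [← Real.exp_add]; ring_nf
    simp_rw [h3]
    rw [integral_mul_const, this, neg_div_neg_eq, div_mul_eq_mul_div, ← Real.exp_add]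
    have : -(b / (v : ℝ)) * b + b / v * b = 0 := by ring
    rw [this, Real.exp_zero]; field_simp
  rw [measureReal_def, gaussianReal_apply_eq_integral _ hv, ENNReal.toReal_ofReal (by
    apply integral_nonneg; intro z; exact gaussianPDFReal_nonneg _ _ _), integral_Ici_eq_integral_Ioi]
  -- The exponent is concave in `z`, hence below its tangent at `b`; the density is dominated by an
  -- exponential with integral `v / b`.
  have key : ∀ z ∈ Set.Ioi b, gaussianPDFReal 0 v z
      ≤ (√v)⁻¹ * Real.exp (-b ^ 2 / (2 * v)) * Real.exp (-(b / v) * (z - b)) := by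
    intro z _
    rw [gaussianPDFReal, mul_assoc (√(v : ℝ))⁻¹, ← Real.exp_add]
    have h1 : (√(2 * Real.pi * v))⁻¹ ≤ (√v)⁻¹ := by
      apply inv_anti₀ (by positivity)
      apply Real.sqrt_le_sqrt
      nlinarith [Real.pi_gt_three]
    have h2 : -(z - 0) ^ 2 / (2 * v) ≤ -b ^ 2 / (2 * v) + -(b / v) * (z - b) := by
      have : -b ^ 2 / (2 * v) + -(b / v) * (z - b) - -(z - 0) ^ 2 / (2 * (v : ℝ))
        = (z - b) ^ 2 / (2 * v) := by field_simp; ring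
      have h3 : 0 ≤ (z - b) ^ 2 / (2 * (v : ℝ)) := by positivity
      linarith
    exact mul_le_mul h1 (Real.exp_le_exp.2 h2) (Real.exp_pos _).le (by positivity)
  refine (setIntegral_mono_on (integrable_gaussianPDFReal 0 v).integrableOn (hint.const_mul _)
    measurableSet_Ioi key).trans (le_of_eq ?_)
  rw [integral_const_mul, hval]
  have : (v : ℝ) = √v * √v := (Real.mul_self_sqrt hv'.le).symm
  have hs : 0 < √(v : ℝ) := Real.sqrt_pos.2 hv'
  field_simp
  rw [Real.sq_sqrt hv'.le]

/-- A centred Gaussian measure gives mass at least `1/2` to a half-line that contains `0`. -/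
lemma half_le_gaussianReal_Ici (v : ℝ≥0) {b : ℝ} (hb : b ≤ 0) :
    1 / 2 ≤ gaussianReal 0 v (Set.Ici b) := by
  have hsymm : gaussianReal 0 v (Set.Iic 0) = gaussianReal 0 v (Set.Ici 0) := by
    have h := gaussianReal_map_neg (μ := 0) (v := v)
    rw [neg_zero] at h
    conv_lhs => rw [← h]
    rw [Measure.map_apply measurable_neg measurableSet_Iic]
    congr 1; ext z; simp
  have hle : (1 : ENNReal) ≤ gaussianReal 0 v (Set.Ici 0) + gaussianReal 0 v (Set.Ici 0) := by
    calc (1 : ENNReal) = gaussianReal 0 v (Set.Iic 0 ∪ Set.Ici 0) := by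
          rw [Set.Iic_union_Ici, measure_univ]
      _ ≤ _ := (measure_union_le _ _).trans (by rw [hsymm])
  have : 1 / 2 ≤ gaussianReal 0 v (Set.Ici 0) := by
    rw [ENNReal.div_le_iff (by simp) (by simp), mul_two]; exact hle
  exact this.trans (measure_mono (Set.Ici_subset_Ici.2 hb))

/-- A lower bound for the mass of a short interval far in the upper tail. -/
lemma le_gaussianReal_real_Icc (ν : ℝ) {σ x : ℝ} (hσ : 0 < σ) (hx : 1 ≤ x) {v : ℝ≥0}
    (hv : (v : ℝ) = σ ^ 2) :
    Real.exp (-(x ^ 2) / 2) / x / 400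
      ≤ (gaussianReal ν v).real (Set.Icc (ν + σ * x + σ / x) (ν + σ * x + 2 * (σ / x))) := by
  have hx0 : 0 < x := by linarith
  have hv0 : v ≠ 0 := by
    rintro rfl
    exact (pow_pos hσ 2).ne (by simpa using hv)
  have hv' : (0 : ℝ) < v := by positivity
  have hq : 0 < σ / x := by positivity
  rw [measureReal_def, gaussianReal_apply_eq_integral _ hv0, ENNReal.toReal_ofReal (by
    apply integral_nonneg; intro z; exact gaussianPDFReal_nonneg _ _ _)]
  have hconst : ∫ _ in Set.Icc (ν + σ * x + σ / x) (ν + σ * x + 2 * (σ / x)),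
      (√(2 * Real.pi * v))⁻¹ * Real.exp (-(x ^ 2) / 2 - 4)
      = (σ / x) * ((√(2 * Real.pi * v))⁻¹ * Real.exp (-(x ^ 2) / 2 - 4)) := by
    rw [setIntegral_const, measureReal_def, Real.volume_Icc, ENNReal.toReal_ofReal (by linarith)]
    simp only [smul_eq_mul]; ring
  have hmono : ∫ _ in Set.Icc (ν + σ * x + σ / x) (ν + σ * x + 2 * (σ / x)),
      (√(2 * Real.pi * v))⁻¹ * Real.exp (-(x ^ 2) / 2 - 4)
      ≤ ∫ z in Set.Icc (ν + σ * x + σ / x) (ν + σ * x + 2 * (σ / x)), gaussianPDFReal ν v z := by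
    apply setIntegral_mono_on (integrableOn_const (by simp)) (integrable_gaussianPDFReal ν v).integrableOn
      measurableSet_Icc
    intro z hz
    rw [gaussianPDFReal]
    apply mul_le_mul_of_nonneg_left _ (by positivity)
    apply Real.exp_le_exp.2
    have h1 : 0 ≤ z - ν := by nlinarith [hz.1, mul_pos hσ hx0]
    have h2 : z - ν ≤ σ * (x + 2 / x) := by
      have := hz.2
      have e : σ * (x + 2 / x) = σ * x + 2 * (σ / x) := by ring
      linarith
    have h3 : (z - ν) ^ 2 ≤ σ ^ 2 * (x + 2 / x) ^ 2 := by
      rw [← mul_pow]; exact pow_le_pow_left₀ h1 h2 2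
    -- On an interval at this distance and of length `σ / x` the density falls below its value at `ν
    -- + σ * x` by a factor of at most `exp 4`.
    have h4 : (x + 2 / x) ^ 2 ≤ x ^ 2 + 8 := by
      have : (2 / x) ≤ 2 := by rw [div_le_iff₀ hx0]; linarith
      have h0 : 0 < 2 / x := by positivity
      have e : x * (2 / x) = 2 := by field_simp
      nlinarith
    rw [neg_div _ ((z - ν) ^ 2), hv]
    have h5 : (z - ν) ^ 2 / (2 * σ ^ 2) ≤ (x ^ 2 + 8) / 2 := by
      rw [div_le_div_iff₀ (by positivity) (by norm_num)]
      nlinarith [mul_le_mul_of_nonneg_left h4 (sq_nonneg σ)]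
    linarith
  refine le_trans ?_ (hconst ▸ hmono)
  have hs : √(2 * Real.pi * v) ≤ 3 * σ := by
    rw [hv]
    apply Real.sqrt_le_iff.2 ⟨by positivity, ?_⟩
    nlinarith [Real.pi_lt_d2, sq_pos_of_pos hσ]
  have hs0 : 0 < √(2 * Real.pi * v) := Real.sqrt_pos.2 (by positivity)
  have hi : (3 * σ)⁻¹ ≤ (√(2 * Real.pi * v))⁻¹ := inv_anti₀ hs0 hs
  have he : (1 / 100 : ℝ) ≤ Real.exp (-4) := by
    rw [Real.exp_neg, one_div]
    apply inv_anti₀ (Real.exp_pos _)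
    have h1 : Real.exp 4 = Real.exp 1 ^ 4 := by rw [← Real.exp_nat_mul]; norm_num
    rw [h1]
    calc Real.exp 1 ^ 4 ≤ (2.7182818286 : ℝ) ^ 4 :=
          pow_le_pow_left₀ (Real.exp_pos _).le Real.exp_one_lt_d9.le 4
      _ ≤ 100 := by norm_num
  rw [sub_eq_add_neg, Real.exp_add]
  have hE := Real.exp_pos (-(x ^ 2) / 2)
  calc Real.exp (-(x ^ 2) / 2) / x / 400
      ≤ σ / x * ((3 * σ)⁻¹ * (Real.exp (-(x ^ 2) / 2) * (1 / 100))) := by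
        have : σ / x * ((3 * σ)⁻¹ * (Real.exp (-(x ^ 2) / 2) * (1 / 100)))
          = Real.exp (-(x ^ 2) / 2) / x / 300 := by field_simp; norm_num
        rw [this]
        apply div_le_div_of_nonneg_left (by positivity) (by norm_num) (by norm_num)
    _ ≤ _ := by gcongr

lemma integrable_id_gaussianReal (ν : ℝ) (v : ℝ≥0) : Integrable (fun z : ℝ => z) (gaussianReal ν v) :=
  (memLp_id_gaussianReal (μ := ν) (v := v) 1).integrable le_rfl

/-- Integrate the arithmetic-geometric mean inequality `|z - ν| ≤ σ / 2 + (z - ν) ^ 2 / (2 * σ)`. -/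
lemma integral_abs_sub_gaussianReal_le (ν : ℝ) {σ : ℝ} (hσ : 0 < σ) {v : ℝ≥0}
    (hv : (v : ℝ) = σ ^ 2) : ∫ z, |z - ν| ∂gaussianReal ν v ≤ σ := by
  have hsq : ∫ z, (z - ν) ^ 2 ∂gaussianReal ν v = σ ^ 2 := by
    have := variance_fun_id_gaussianReal (μ := ν) (v := v)
    rw [variance_eq_integral (by fun_prop), integral_id_gaussianReal, hv] at this
    exact this
  have hL : Integrable (fun z : ℝ => (z - ν) ^ 2) (gaussianReal ν v) :=
    ((memLp_id_gaussianReal (μ := ν) (v := v) 2).sub (memLp_const ν)).integrable_sq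
  calc ∫ z, |z - ν| ∂gaussianReal ν v
      ≤ ∫ z, (σ / 2 + (z - ν) ^ 2 / (2 * σ)) ∂gaussianReal ν v := by
        apply integral_mono
        · exact ((integrable_id_gaussianReal ν v).sub (integrable_const ν)).abs
        · exact (integrable_const _).add (hL.div_const _)
        · intro z
          simp only
          have : σ / 2 + (z - ν) ^ 2 / (2 * σ) - |z - ν| = (σ - |z - ν|) ^ 2 / (2 * σ) := by
            rw [sub_sq σ, sq_abs]; field_simp; ring
          have h2 : 0 ≤ (σ - |z - ν|) ^ 2 / (2 * σ) := by positivity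
          linarith
    _ = σ := by
        rw [integral_add (integrable_const _) (hL.div_const _), integral_div (2 * σ), hsq]
        simp; field_simp; norm_num

/-! ### Sums of independent standard Gaussian variables -/

/-- The law of the noise of the successive plays of an arm. -/
def noiseMeasure : Measure (ℕ → ℝ) := Measure.infinitePi fun _ : ℕ => gaussianReal 0 1

instance : IsProbabilityMeasure noiseMeasure := by unfold noiseMeasure; infer_instance

/-- The sum of the first `k` noise variables. -/
def noiseSum (k : ℕ) (ω : ℕ → ℝ) : ℝ := ∑ s ∈ Finset.range k, ω s

@[fun_prop]
lemma measurable_noiseSum (k : ℕ) : Measurable (noiseSum k) := by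
  unfold noiseSum; fun_prop

lemma iIndepFun_noise : iIndepFun (fun (i : ℕ) (ω : ℕ → ℝ) => ω i) noiseMeasure :=
  iIndepFun_infinitePi (X := fun _ (z : ℝ) => z) (P := fun _ => gaussianReal 0 1)
    (fun _ => measurable_id)

lemma map_eval_noiseMeasure (k : ℕ) :
    noiseMeasure.map (fun ω => ω k) = gaussianReal 0 1 :=
  Measure.infinitePi_map_eval (fun _ : ℕ => gaussianReal 0 1) k

lemma map_noiseSum (k : ℕ) : noiseMeasure.map (noiseSum k) = gaussianReal 0 k := by
  induction k with
  | zero =>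
    have : noiseSum 0 = fun _ => (0 : ℝ) := by funext ω; simp [noiseSum]
    rw [this, Measure.map_const]
    simp
  | succ k ih =>
    have hind : IndepFun (noiseSum k) (fun ω : ℕ → ℝ => ω k) noiseMeasure := by
      have := iIndepFun_noise.indepFun_finsetSum_of_notMem (fun i => measurable_pi_apply i)
        (s := Finset.range k) (i := k) (by simp)
      convert this using 1
      funext ω; simp [noiseSum]
    have := gaussianReal_add_gaussianReal_of_indepFun hind ih (map_eval_noiseMeasure k)
    rw [add_zero] at this
    have e : noiseSum (k + 1) = noiseSum k + fun ω : ℕ → ℝ => ω k := by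
      funext ω; simp [noiseSum, Finset.sum_range_succ]
    rw [e, this]; push_cast; rfl

lemma noiseMeasure_real_noiseSum_ge_le {k : ℕ} (hk : 0 < k) {r : ℝ} (hr : 0 ≤ r) :
    noiseMeasure.real {ω | r ≤ noiseSum k ω} ≤ Real.exp (-r ^ 2 / (2 * k)) := by
  have h := gaussianReal_real_Ici_le 0 (v := (k : ℝ≥0)) (by positivity) hr
  rw [zero_add, measureReal_def, ← map_noiseSum k,
    Measure.map_apply (measurable_noiseSum k) measurableSet_Ici] at h
  simpa [measureReal_def, Set.preimage, Set.mem_Ici] using h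

lemma half_le_noiseMeasure_real_noiseSum_nonneg (k : ℕ) :
    1 / 2 ≤ noiseMeasure.real {ω | 0 ≤ noiseSum k ω} := by
  have h := half_le_gaussianReal_Ici (k : ℝ≥0) (le_refl (0 : ℝ))
  rw [← map_noiseSum k, Measure.map_apply (measurable_noiseSum k) measurableSet_Ici] at h
  have h2 := ENNReal.toReal_mono (by finiteness) h
  simpa [measureReal_def, Set.preimage, Set.mem_Ici] using h2

/-- A function of the first `k` noise variables is independent of the next one. -/
lemma lintegral_mul_noise_eq {k : ℕ} {G : (ℕ → ℝ) → ENNReal} (hG : Measurable G)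
    (hdep : ∀ ω ω' : ℕ → ℝ, (∀ i < k, ω i = ω' i) → G ω = G ω')
    {g : ℝ → ENNReal} (hg : Measurable g) :
    ∫⁻ ω, G ω * g (ω k) ∂noiseMeasure
      = (∫⁻ ω, G ω ∂noiseMeasure) * ∫⁻ z, g z ∂gaussianReal 0 1 := by
  -- Extension by zero exhibits `G` as a measurable function of the first `k` coordinates alone, to
  -- which independence of finite blocks applies.
  let ext : (Finset.range k → ℝ) → ℕ → ℝ := fun f i => if h : i ∈ Finset.range k then f ⟨i, h⟩ else 0
  have hext : Measurable ext := by
    refine measurable_pi_lambda _ fun i => ?_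
    by_cases h : i ∈ Finset.range k
    · simp only [ext, h, dite_true]; exact measurable_pi_apply _
    · simp only [ext, h, dite_false]; exact measurable_const
  have hGe : ∀ ω : ℕ → ℝ, G (ext fun i => ω i) = G ω := fun ω => hdep _ _ fun i hi => by
    simp [ext, hi]
  have hind := iIndepFun_noise.indepFun_finset (Finset.range k) {k} (by simp)
    (fun i => measurable_pi_apply i)
  have hg' : Measurable fun f : ({k} : Finset ℕ) → ℝ => g (f ⟨k, by simp⟩) :=
    hg.comp (measurable_pi_apply _)
  have hind' := hind.comp (hG.comp hext) hg'
  have := lintegral_mul_eq_lintegral_mul_lintegral_of_indepFun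
    ((hG.comp hext).comp (by fun_prop)) (hg'.comp (by fun_prop)) hind'
  simp only [Pi.mul_apply, Function.comp_apply, hGe] at this
  rw [this, ← map_eval_noiseMeasure k, lintegral_map hg (measurable_pi_apply k)]

lemma noiseSum_congr {j k : ℕ} (hj : j ≤ k) {ω ω' : ℕ → ℝ} (h : ∀ i < k, ω i = ω' i) :
    noiseSum j ω = noiseSum j ω' :=
  Finset.sum_congr rfl fun i hi => h i ((Finset.mem_range.1 hi).trans_le hj)

/-- The noise crosses a line of slope `-u / 2` and height `-a` with probability at most
`exp (-(a * u))`. -/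
lemma noiseMeasure_crossing_le {a u : ℝ} (hu : 0 ≤ u) (k : ℕ) :
    noiseMeasure {ω | ∃ j ≤ k, 1 ≤ j ∧ noiseSum j ω ≤ -a - u / 2 * j}
      ≤ ENNReal.ofReal (Real.exp (-(a * u))) := by
  let A : ℕ → Set (ℕ → ℝ) := fun k => {ω | ∃ j ≤ k, 1 ≤ j ∧ noiseSum j ω ≤ -a - u / 2 * j}
  -- This is the exponential martingale with parameter `-u`; at a crossing of the line its value is
  -- at least `exp (a * u)`.
  let D : ℕ → (ℕ → ℝ) → ENNReal := fun k ω =>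
    ENNReal.ofReal (Real.exp (-u * noiseSum k ω - u ^ 2 * k / 2))
  have hA : ∀ k, MeasurableSet (A k) := fun k => by
    have : A k = ⋃ j ∈ Finset.Icc 1 k, {ω | noiseSum j ω ≤ -a - u / 2 * j} := by
      ext ω; simp only [A, Set.mem_ofPred_eq, Set.mem_iUnion, Finset.mem_Icc]
      constructor
      · rintro ⟨j, h1, h2, h3⟩; exact ⟨j, ⟨h2, h1⟩, h3⟩
      · rintro ⟨j, ⟨h2, h1⟩, h3⟩; exact ⟨j, h1, h2, h3⟩
    rw [this]
    exact Finset.measurableSet_biUnion _ fun j _ =>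
      measurableSet_le (measurable_noiseSum j) measurable_const
  have hD : ∀ k, Measurable (D k) := fun k => by
    have := measurable_noiseSum k
    simp only [D]; fun_prop
  have hAdep : ∀ k (ω ω' : ℕ → ℝ), (∀ i < k, ω i = ω' i) → (ω ∈ A k ↔ ω' ∈ A k) := by
    intro k ω ω' h
    simp only [A, Set.mem_ofPred_eq]
    refine exists_congr fun j => and_congr_right fun hj => ?_
    rw [noiseSum_congr hj h]
  have hstep : ∀ k, ∫⁻ ω, (A k)ᶜ.indicator (D (k + 1)) ω ∂noiseMeasure
      = ∫⁻ ω, (A k)ᶜ.indicator (D k) ω ∂noiseMeasure := by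
    intro k
    have hfac : ∀ ω, (A k)ᶜ.indicator (D (k + 1)) ω = (A k)ᶜ.indicator (D k) ω
        * ENNReal.ofReal (Real.exp (-u ^ 2 / 2) * Real.exp (-u * ω k)) := by
      intro ω
      by_cases h : ω ∈ (A k)ᶜ
      · rw [Set.indicator_of_mem h, Set.indicator_of_mem h]
        simp only [D]
        rw [← ENNReal.ofReal_mul (Real.exp_pos _).le, ← Real.exp_add, ← Real.exp_add]
        congr 2
        simp only [noiseSum, Finset.sum_range_succ]; push_cast; ring
      · simp [Set.indicator_of_notMem h]
    simp_rw [hfac]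
    rw [lintegral_mul_noise_eq (g := fun z => ENNReal.ofReal
      (Real.exp (-u ^ 2 / 2) * Real.exp (-u * z))) ((hD k).indicator (hA k).compl) _ (by fun_prop)]
    · simp_rw [ENNReal.ofReal_mul (Real.exp_pos (-u ^ 2 / 2)).le]
      rw [lintegral_const_mul _ (by fun_prop), lintegral_exp_mul_gaussianReal,
        ← ENNReal.ofReal_mul (Real.exp_pos _).le, ← Real.exp_add]
      have : -u ^ 2 / 2 + (0 * -u + ((1 : ℝ≥0) : ℝ) * (-u) ^ 2 / 2) = 0 := by simp; ring
      rw [this]; simp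
    · intro ω ω' h
      by_cases hω : ω ∈ A k
      · rw [Set.indicator_of_notMem (by simpa using hω),
          Set.indicator_of_notMem (by simpa using (hAdep k ω ω' h).1 hω)]
      · rw [Set.indicator_of_mem (by simpa using hω),
          Set.indicator_of_mem (by simpa using fun h' => hω ((hAdep k ω ω' h).2 h'))]
        simp only [D, noiseSum_congr le_rfl h]
  -- Ville's inequality by induction: the martingale frozen at the first crossing, with its value
  -- there lowered to `exp (a * u)`, has mean at most `1`.
  have hmain : ∀ k, ENNReal.ofReal (Real.exp (a * u)) * noiseMeasure (A k)
      + ∫⁻ ω, (A k)ᶜ.indicator (D k) ω ∂noiseMeasure ≤ 1 := by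
    intro k
    induction k with
    | zero =>
      have h0 : A 0 = ∅ := by
        ext ω
        simp only [A, Set.mem_ofPred_eq, Set.mem_empty_iff_false, iff_false]
        rintro ⟨j, h1, h2, -⟩; omega
      simp [h0, D, noiseSum]
    | succ k ih =>
      refine le_trans ?_ ih
      rw [← hstep k]
      have hsub : A k ⊆ A (k + 1) := fun ω ⟨j, h1, h2⟩ => ⟨j, by omega, h2⟩
      have hpt : ∀ ω, (A (k + 1)).indicator (fun _ => ENNReal.ofReal (Real.exp (a * u))) ω
          + (A (k + 1))ᶜ.indicator (D (k + 1)) ω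
          ≤ (A k).indicator (fun _ => ENNReal.ofReal (Real.exp (a * u))) ω
          + (A k)ᶜ.indicator (D (k + 1)) ω := by
        intro ω
        by_cases h : ω ∈ A k
        · simp [h, hsub h]
        · by_cases h' : ω ∈ A (k + 1)
          · simp only [h, h', Set.indicator_of_mem, Set.indicator_of_notMem, Set.mem_compl_iff,
              not_true_eq_false, not_false_eq_true, add_zero, zero_add]
            apply ENNReal.ofReal_le_ofReal
            apply Real.exp_le_exp.2
            obtain ⟨j, h1, h2, h3⟩ := h'
            have hj : j = k + 1 := by
              by_contra hne
              exact h ⟨j, by omega, h2, h3⟩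
            subst hj
            nlinarith [mul_le_mul_of_nonneg_left h3 hu]
          · simp [h, h']
      have := lintegral_mono hpt (μ := noiseMeasure)
      rw [lintegral_add_left ((measurable_const).indicator (hA _)),
        lintegral_add_left ((measurable_const).indicator (hA _)),
        lintegral_indicator_const (hA _), lintegral_indicator_const (hA _)] at this
      exact this
  have h1 := le_trans le_self_add (hmain k)
  rw [Real.exp_neg, ENNReal.ofReal_inv_of_pos (Real.exp_pos _), ← one_div,
    ENNReal.le_div_iff_mul_le (by left; simp [Real.exp_pos]) (by left; simp), mul_comm]
  exact h1

/-! ### Elementary properties of the Gittins index -/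

lemma armMeasure_eq (ν : ℝ) (v : ℝ≥0) : armMeasure ν v = (gaussianReal ν v).prod noiseMeasure := rfl

instance (ν : ℝ) (v : ℝ≥0) : IsProbabilityMeasure (armMeasure ν v) := by
  rw [armMeasure_eq]; infer_instance

lemma integral_armMeasure_fst (ν : ℝ) (v : ℝ≥0) (f : ℝ → ℝ) :
    ∫ ω, f ω.1 ∂armMeasure ν v = ∫ z, f z ∂gaussianReal ν v := by
  rw [armMeasure_eq, integral_fun_fst]; simp

lemma integrable_armMeasure_fst {ν : ℝ} {v : ℝ≥0} {f : ℝ → ℝ}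
    (hf : Integrable f (gaussianReal ν v)) :
    Integrable (fun ω : ArmSpace => f ω.1) (armMeasure ν v) := by
  rw [armMeasure_eq]; exact hf.comp_fst _

lemma IsArmStoppingTime.measurable {m : ℕ} {τ : ArmSpace → ℕ} (h : IsArmStoppingTime m τ) :
    Measurable τ := by
  refine measurable_of_Iic fun i => ?_
  have := armFiltration.le i _ (h.1 i)
  simpa [Set.preimage, Set.Iic] using this

lemma isArmStoppingTime_one {m : ℕ} (hm : 1 ≤ m) : IsArmStoppingTime m fun _ => 1 :=
  ⟨isStoppingTime_const _ 1, fun _ => ⟨le_rfl, hm⟩⟩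

lemma IsArmStoppingTime.integrable {m : ℕ} {τ : ArmSpace → ℕ} (h : IsArmStoppingTime m τ)
    (ν : ℝ) (v : ℝ≥0) (γ : ℝ) :
    Integrable (fun ω : ArmSpace => (ω.1 - γ) * (τ ω : ℝ)) (armMeasure ν v) := by
  have h1 : Integrable (fun ω : ArmSpace => ω.1 - γ) (armMeasure ν v) :=
    integrable_armMeasure_fst ((integrable_id_gaussianReal ν v).sub (integrable_const γ))
  refine h1.mul_bdd (c := m) ?_ (ae_of_all _ fun ω => ?_)
  · exact (measurable_from_nat.comp h.measurable : Measurable fun ω => (τ ω : ℝ)).aestronglyMeasurable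
  · simpa using (h.2 ω).2

lemma integrable_exp_mul_sub_gaussianReal (ν : ℝ) (v : ℝ≥0) (l γ : ℝ) :
    Integrable (fun z => Real.exp (l * (z - γ))) (gaussianReal ν v) := by
  have := (integrable_exp_mul_gaussianReal (μ := ν) (v := v) l).mul_const (Real.exp (-(l * γ)))
  refine this.congr (ae_of_all _ fun z => ?_)
  simp only
  rw [← Real.exp_add]; ring_nf

/-- The slope `x / σ` is the Chernoff-optimal one for the level `ν + σ * x`. -/
lemma integral_exp_tilt_gaussianReal (ν : ℝ) {v : ℝ≥0} {σ : ℝ} (hσ : 0 < σ)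
    (hv : (v : ℝ) = σ ^ 2) (x : ℝ) :
    ∫ z, Real.exp (x / σ * (z - (ν + σ * x))) ∂gaussianReal ν v = Real.exp (-(x ^ 2) / 2) := by
  have : ∀ z, Real.exp (x / σ * (z - (ν + σ * x)))
      = Real.exp (x / σ * z) * Real.exp (-(x / σ * (ν + σ * x))) := by
    intro z; rw [← Real.exp_add]; ring_nf
  simp_rw [this]
  rw [integral_mul_const, integral_exp_mul_gaussianReal, ← Real.exp_add, hv]
  congr 1
  field_simp; ring

lemma exp_upper_bound_pos_part {l w : ℝ} (hl : 0 < l) : max w 0 ≤ Real.exp (l * w) / l := by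
  rw [le_div_iff₀ hl]
  rcases le_total w 0 with h | h
  · rw [max_eq_right h, zero_mul]; exact (Real.exp_pos _).le
  · rw [max_eq_left h]; nlinarith [Real.add_one_le_exp (l * w)]

/-- The first play is compulsory and loses `σ * x` in mean. The at most `m - 1` further plays gain
only through the positive part of `θ - γ`, which is dominated by the exponential of slope `x / σ`.
-/
lemma IsArmStoppingTime.integral_le {m : ℕ} {τ : ArmSpace → ℕ} (h : IsArmStoppingTime m τ)
    (ν : ℝ) {v : ℝ≥0} {σ x : ℝ} (hσ : 0 < σ) (hv : (v : ℝ) = σ ^ 2) (hx : 0 < x) :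
    ∫ ω, (ω.1 - (ν + σ * x)) * (τ ω : ℝ) ∂armMeasure ν v
      ≤ σ * (-x + m * Real.exp (-(x ^ 2) / 2) / x) := by
  set γ := ν + σ * x with hγ
  have hl : 0 < x / σ := by positivity
  have i1 : Integrable (fun z : ℝ => z - γ) (gaussianReal ν v) :=
    (integrable_id_gaussianReal ν v).sub (integrable_const γ)
  have i2 := integrable_exp_mul_sub_gaussianReal ν v (x / σ) γ
  have e2 := integral_exp_tilt_gaussianReal ν hσ hv x
  rw [← hγ] at e2
  calc ∫ ω, (ω.1 - γ) * (τ ω : ℝ) ∂armMeasure ν v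
      ≤ ∫ ω, (fun z => (z - γ) + m * (Real.exp (x / σ * (z - γ)) / (x / σ))) ω.1
          ∂armMeasure ν v := by
        apply integral_mono (h.integrable ν v γ)
        · exact integrable_armMeasure_fst (i1.add ((i2.div_const _).const_mul _))
        · intro ω
          simp only
          have h1 : (1 : ℝ) ≤ τ ω := by exact_mod_cast (h.2 ω).1
          have h2 : (τ ω : ℝ) ≤ m := by exact_mod_cast (h.2 ω).2
          have h3 := exp_upper_bound_pos_part (w := ω.1 - γ) hl
          have h4 : (ω.1 - γ) * (τ ω - 1) ≤ m * max (ω.1 - γ) 0 := by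
            calc (ω.1 - γ) * (τ ω - 1) ≤ max (ω.1 - γ) 0 * (τ ω - 1) :=
                  mul_le_mul_of_nonneg_right (le_max_left _ _) (by linarith)
              _ ≤ max (ω.1 - γ) 0 * m :=
                  mul_le_mul_of_nonneg_left (by linarith) (le_max_right _ _)
              _ = _ := mul_comm _ _
          have h5 : (m : ℝ) * max (ω.1 - γ) 0 ≤ m * (Real.exp (x / σ * (ω.1 - γ)) / (x / σ)) :=
            mul_le_mul_of_nonneg_left h3 (by positivity)
          nlinarith
    _ = σ * (-x + m * Real.exp (-(x ^ 2) / 2) / x) := by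
        rw [integral_armMeasure_fst ν v
          (fun z => (z - γ) + m * (Real.exp (x / σ * (z - γ)) / (x / σ)))]
        rw [integral_add i1 ((i2.div_const _).const_mul _), integral_const_mul, integral_div, e2]
        rw [integral_sub (integrable_id_gaussianReal ν v) (integrable_const γ),
          integral_id_gaussianReal]
        simp only [integral_const, probReal_univ, smul_eq_mul, one_mul, hγ]
        field_simp; ring

lemma bddAbove_stoppingValue_set (ν : ℝ) (v : ℝ≥0) (m : ℕ) (γ : ℝ) :
    BddAbove {x : ℝ | ∃ τ : ArmSpace → ℕ, IsArmStoppingTime m τ ∧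
      x = ∫ ω, (ω.1 - γ) * (τ ω : ℝ) ∂(armMeasure ν v)} := by
  refine ⟨∫ ω : ArmSpace, |ω.1 - γ| * m ∂armMeasure ν v, ?_⟩
  rintro _ ⟨τ, hτ, rfl⟩
  apply integral_mono (hτ.integrable ν v γ)
  · have h1 : Integrable (fun ω : ArmSpace => ω.1 - γ) (armMeasure ν v) :=
      integrable_armMeasure_fst ((integrable_id_gaussianReal ν v).sub (integrable_const γ))
    exact h1.abs.mul_const _
  · intro ω
    have h2 : (τ ω : ℝ) ≤ m := by exact_mod_cast (hτ.2 ω).2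
    exact mul_le_mul (le_abs_self _) h2 (by positivity) (abs_nonneg _)

lemma stoppingValue_mean_nonneg (ν : ℝ) (v : ℝ≥0) {m : ℕ} (hm : 1 ≤ m) :
    0 ≤ stoppingValue ν v m ν := by
  refine le_csSup (bddAbove_stoppingValue_set ν v m ν) ⟨_, isArmStoppingTime_one hm, ?_⟩
  rw [integral_armMeasure_fst ν v (fun z => (z - ν) * ((1 : ℕ) : ℝ))]
  rw [integral_mul_const, integral_sub (integrable_id_gaussianReal ν v) (integrable_const ν),
    integral_id_gaussianReal]
  simp

lemma le_of_stoppingValue_nonneg {ν : ℝ} {v : ℝ≥0} {m : ℕ} (hm : 1 ≤ m) {σ x γ : ℝ} (hσ : 0 < σ)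
    (hv : (v : ℝ) = σ ^ 2) (hx : 1 ≤ x) (hmx : (m : ℝ) ≤ Real.exp (x ^ 2 / 2))
    (h : 0 ≤ stoppingValue ν v m γ) : γ ≤ ν + σ * x := by
  by_contra! hlt
  obtain ⟨x', hx'⟩ : ∃ x', γ = ν + σ * x' := ⟨(γ - ν) / σ, by field_simp; ring⟩
  have hxx : x < x' := by
    have : σ * x < σ * x' := by linarith
    exact lt_of_mul_lt_mul_left this hσ.le
  have hneg : σ * (-x' + m * Real.exp (-(x' ^ 2) / 2) / x') < 0 := by
    have h1 : (m : ℝ) * Real.exp (-(x' ^ 2) / 2) < 1 := by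
      calc (m : ℝ) * Real.exp (-(x' ^ 2) / 2)
          ≤ Real.exp (x ^ 2 / 2) * Real.exp (-(x' ^ 2) / 2) := by gcongr
        _ < 1 := by
          rw [← Real.exp_add, Real.exp_lt_one_iff]
          nlinarith
    have h2 : (m : ℝ) * Real.exp (-(x' ^ 2) / 2) / x' < x' := by
      rw [div_lt_iff₀ (by linarith)]; nlinarith
    exact mul_neg_of_pos_of_neg hσ (by linarith)
  have hle : stoppingValue ν v m γ ≤ σ * (-x' + m * Real.exp (-(x' ^ 2) / 2) / x') := by
    unfold stoppingValue
    refine csSup_le ⟨_, _, isArmStoppingTime_one hm, rfl⟩ ?_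
    rintro _ ⟨τ, hτ, rfl⟩
    rw [hx']
    exact hτ.integral_le ν hσ hv (by linarith)
  linarith

/-- The Gittins index is at most `ν + σ * x` as soon as `x ≥ 1` and `log m ≤ x ^ 2 / 2`. -/
lemma gittinsIndex_le {ν : ℝ} {v : ℝ≥0} {m : ℕ} (hm : 1 ≤ m) {σ x : ℝ} (hσ : 0 < σ)
    (hv : (v : ℝ) = σ ^ 2) (hx : 1 ≤ x) (hmx : (m : ℝ) ≤ Real.exp (x ^ 2 / 2)) :
    gittinsIndex ν v m ≤ ν + σ * x :=
  csSup_le ⟨ν, stoppingValue_mean_nonneg ν v hm⟩ fun _ h =>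
    le_of_stoppingValue_nonneg hm hσ hv hx hmx h

lemma le_gittinsIndex_of_stoppingValue_nonneg {ν : ℝ} {v : ℝ≥0} (hv : v ≠ 0) {m : ℕ} (hm : 1 ≤ m)
    {γ : ℝ} (h : 0 ≤ stoppingValue ν v m γ) : γ ≤ gittinsIndex ν v m := by
  -- The supremum needs a bounded set; `x = m + 1` is a crude choice that satisfies `m ≤ exp (x ^ 2
  -- / 2)`.
  refine le_csSup ⟨ν + √v * (m + 1), fun γ' h' => ?_⟩ h
  have hm' : (1 : ℝ) ≤ m := by exact_mod_cast hm
  refine le_of_stoppingValue_nonneg hm (Real.sqrt_pos.2 (by positivity))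
    (Real.sq_sqrt v.coe_nonneg).symm (by linarith) ?_ h'
  nlinarith [Real.add_one_le_exp (((m : ℝ) + 1) ^ 2 / 2)]

lemma le_gittinsIndex_of_isArmStoppingTime {ν : ℝ} {v : ℝ≥0} (hv : v ≠ 0) {m : ℕ} (hm : 1 ≤ m)
    {γ : ℝ} {τ : ArmSpace → ℕ} (hτ : IsArmStoppingTime m τ)
    (h : 0 ≤ ∫ ω, (ω.1 - γ) * (τ ω : ℝ) ∂(armMeasure ν v)) : γ ≤ gittinsIndex ν v m :=
  le_gittinsIndex_of_stoppingValue_nonneg hv hm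
    (h.trans (le_csSup (bddAbove_stoppingValue_set ν v m γ) ⟨τ, hτ, rfl⟩))

/-- The Gittins index is at least the mean. -/
lemma le_gittinsIndex (ν : ℝ) {v : ℝ≥0} (hv : v ≠ 0) {m : ℕ} (hm : 1 ≤ m) :
    ν ≤ gittinsIndex ν v m :=
  le_gittinsIndex_of_stoppingValue_nonneg hv hm (stoppingValue_mean_nonneg ν v hm)

/-! ### A lower bound for the Gittins index

The index is bounded from below by the value of an explicit stopping rule: the observations have to
stay above a falling line for `k₀` plays, and their sum has to be positive after `k₀` plays; then all
remaining rounds are played. -/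

/-- The sum of the first `k` observations, each reduced by `γ`. -/
def armSum (γ : ℝ) (k : ℕ) (ω : ArmSpace) : ℝ := ∑ s ∈ Finset.range k, (armObs s ω - γ)

lemma armSum_eq (γ : ℝ) (k : ℕ) (ω : ArmSpace) :
    armSum γ k ω = k * (ω.1 - γ) + noiseSum k ω.2 := by
  simp only [armSum, armObs, noiseSum]
  simp only [Finset.sum_sub_distrib, Finset.sum_add_distrib, Finset.sum_const, Finset.card_range,
    nsmul_eq_mul]
  ring

lemma measurable_armObs_armFiltration {s k : ℕ} (hs : s < k) :
    Measurable[armFiltration k] (armObs s) := by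
  have h : MeasurableSpace.comap (armObs s) inferInstance ≤ armFiltration k :=
    le_iSup_of_le s (le_iSup_of_le hs le_rfl)
  exact (comap_measurable (armObs s)).mono h le_rfl

lemma measurable_armSum_armFiltration (γ : ℝ) (k : ℕ) :
    Measurable[armFiltration k] (armSum γ k) := by
  unfold armSum
  refine Finset.measurable_fun_sum _ fun s hs => ?_
  exact (measurable_armObs_armFiltration (Finset.mem_range.1 hs)).sub_const γ

/-- The rule stops when this process is nonpositive. -/
def ruleProcess (γ a u : ℝ) (k₀ k : ℕ) (ω : ArmSpace) : ℝ :=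
  if k < k₀ then armSum γ k ω + a + u / 2 * k else if k = k₀ then armSum γ k ω else 1

/-- The stopping rule that tests whether the mean exceeds `γ`. -/
def ruleTime (γ a u : ℝ) (k₀ m : ℕ) (ω : ArmSpace) : ℕ :=
  hittingBtwn (ruleProcess γ a u k₀) (Set.Iic 0) 1 m ω

lemma isArmStoppingTime_ruleTime (γ a u : ℝ) (k₀ : ℕ) {m : ℕ} (hm : 1 ≤ m) :
    IsArmStoppingTime m (ruleTime γ a u k₀ m) := by
  refine ⟨?_, fun ω => ⟨le_hittingBtwn hm ω, hittingBtwn_le ω⟩⟩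
  refine Adapted.isStoppingTime_hittingBtwn (fun k => ?_) measurableSet_Iic
  have h := measurable_armSum_armFiltration γ k
  unfold ruleProcess
  split_ifs
  · exact (h.add_const a).add_const _
  · exact h
  · exact measurable_const

/-- The noise paths on which the rule never stops early when the mean exceeds `γ`. -/
def survivalSet (a u : ℝ) (k₀ : ℕ) : Set (ℕ → ℝ) :=
  {ω | ∃ j ≤ k₀, 1 ≤ j ∧ noiseSum j ω ≤ -a - u / 2 * j}ᶜ ∩ {ω | 0 ≤ noiseSum k₀ ω}

lemma measurableSet_survivalSet (a u : ℝ) (k₀ : ℕ) : MeasurableSet (survivalSet a u k₀) := by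
  refine MeasurableSet.inter (MeasurableSet.compl ?_)
    (measurableSet_le measurable_const (measurable_noiseSum k₀))
  have : {ω | ∃ j ≤ k₀, 1 ≤ j ∧ noiseSum j ω ≤ -a - u / 2 * j}
      = ⋃ j ∈ Finset.Icc 1 k₀, {ω | noiseSum j ω ≤ -a - u / 2 * j} := by
    ext ω; simp only [Set.mem_ofPred_eq, Set.mem_iUnion, Finset.mem_Icc]
    constructor
    · rintro ⟨j, h1, h2, h3⟩; exact ⟨j, ⟨h2, h1⟩, h3⟩
    · rintro ⟨j, ⟨h2, h1⟩, h3⟩; exact ⟨j, h1, h2, h3⟩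
  rw [this]
  exact Finset.measurableSet_biUnion _ fun j _ =>
    measurableSet_le (measurable_noiseSum j) measurable_const

/-- The sum at `k₀` is nonnegative with probability at least `1 / 2`, and the line is crossed with
probability at most `exp (-2) ≤ 1 / 6`. -/
lemma third_le_survivalSet {a u : ℝ} (hu : 0 ≤ u) (hau : a * u = 2) (k₀ : ℕ) :
    1 / 3 ≤ noiseMeasure.real (survivalSet a u k₀) := by
  have h1 := half_le_noiseMeasure_real_noiseSum_nonneg k₀
  have h2 : noiseMeasure.real {ω | ∃ j ≤ k₀, 1 ≤ j ∧ noiseSum j ω ≤ -a - u / 2 * j}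
      ≤ Real.exp (-2) := by
    have h := noiseMeasure_crossing_le (a := a) hu k₀
    rw [hau] at h
    exact ENNReal.toReal_le_of_le_ofReal (Real.exp_pos _).le h
  have h3 : Real.exp (-2) ≤ 1 / 6 := by
    rw [Real.exp_neg, one_div]
    apply inv_anti₀ (by norm_num)
    have : Real.exp 2 = Real.exp 1 ^ 2 := by rw [← Real.exp_nat_mul]; norm_num
    rw [this]; nlinarith [Real.exp_one_gt_d9]
  have h4 : noiseMeasure.real {ω | 0 ≤ noiseSum k₀ ω}
      ≤ noiseMeasure.real (survivalSet a u k₀)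
        + noiseMeasure.real {ω | ∃ j ≤ k₀, 1 ≤ j ∧ noiseSum j ω ≤ -a - u / 2 * j} := by
    refine le_trans (measureReal_mono ?_) (measureReal_union_le _ _)
    intro ω hω
    by_cases h : ω ∈ {ω | ∃ j ≤ k₀, 1 ≤ j ∧ noiseSum j ω ≤ -a - u / 2 * j}
    · exact Or.inr h
    · exact Or.inl ⟨h, hω⟩
  linarith

/-- The number of plays that the rule needs to reject a mean well below `γ`. -/
def rejectionCount (a u : ℝ) (k₀ : ℕ) (ω : ℕ → ℝ) : ℝ :=
  1 + ∑ k ∈ Finset.Ico 1 k₀, {ω : ℕ → ℝ | u / 4 * k - a ≤ noiseSum k ω}.indicator 1 ω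

/-- A mean above `γ` only raises the sums above the noise. Past `k₀` the process is constantly `1`,
so no stop occurs and the hitting time takes its default value `m`. -/
lemma ruleTime_eq_of_mem_survivalSet {γ a u : ℝ} {k₀ m : ℕ} {ω : ArmSpace} (hk : 1 ≤ k₀)
    (hθ : γ < ω.1) (hω : ω.2 ∈ survivalSet a u k₀) : ruleTime γ a u k₀ m ω = m := by
  refine hittingBtwn_eq_end_iff.2 ?_
  rintro ⟨j, ⟨hj1, hjm⟩, hj⟩
  exfalso
  have hθ' : 0 < ω.1 - γ := by linarith
  have hj' : (1 : ℝ) ≤ j := by exact_mod_cast hj1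
  simp only [ruleProcess, armSum_eq, Set.mem_Iic] at hj
  split_ifs at hj with h1 h2
  · apply hω.1
    refine ⟨j, h1.le, hj1, ?_⟩
    nlinarith
  · subst h2
    have := hω.2
    simp only [Set.mem_ofPred_eq] at this
    nlinarith
  · linarith

lemma ruleTime_le {γ a u : ℝ} {k₀ m : ℕ} {ω : ArmSpace} (hm : k₀ ≤ m) (hk : 1 ≤ k₀)
    (hW : armSum γ k₀ ω ≤ 0) : ruleTime γ a u k₀ m ω ≤ k₀ :=
  hittingBtwn_le_of_mem hk hm (by simpa [ruleProcess] using hW)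

/-- As long as the rule goes on, the sum exceeds `-a - u / 2 * k` although its drift is at most `-(3
* u / 4) * k`. The noise must make up the difference `u / 4 * k - a`, and `rejectionCount` counts
the times when it does. -/
lemma ruleTime_le_rejectionCount {γ a u : ℝ} {k₀ m : ℕ} {ω : ArmSpace}
    (hm : k₀ ≤ m) (hk : 1 ≤ k₀) (hθ : ω.1 - γ ≤ -(3 * u / 4)) (hW : armSum γ k₀ ω ≤ 0) :
    (ruleTime γ a u k₀ m ω : ℝ) ≤ rejectionCount a u k₀ ω.2 := by
  set τ := ruleTime γ a u k₀ m ω with hτ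
  have hτk : τ ≤ k₀ := ruleTime_le hm hk hW
  have hτ1 : 1 ≤ τ := le_hittingBtwn (hk.trans hm) ω
  have hsub : ∑ k ∈ Finset.Ico 1 τ, (1 : ℝ) ≤ ∑ k ∈ Finset.Ico 1 k₀,
      {ω : ℕ → ℝ | u / 4 * k - a ≤ noiseSum k ω}.indicator (1 : (ℕ → ℝ) → ℝ) ω.2 := by
    refine le_trans ?_ (Finset.sum_le_sum_of_subset_of_nonneg
      (Finset.Ico_subset_Ico le_rfl hτk) fun k _ _ => Set.indicator_nonneg (by simp) _)
    refine Finset.sum_le_sum fun k hk' => ?_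
    obtain ⟨hk1, hk2⟩ := Finset.mem_Ico.1 hk'
    have hnot : ruleProcess γ a u k₀ k ω ∉ Set.Iic 0 := notMem_of_lt_hittingBtwn hk2 hk1
    have hlt : k < k₀ := hk2.trans_le hτk
    simp only [ruleProcess, hlt, if_true, armSum_eq, Set.mem_Iic, not_le] at hnot
    rw [Set.indicator_of_mem]
    · simp
    · simp only [Set.mem_ofPred_eq]
      have hk0 : (0 : ℝ) ≤ k := by positivity
      nlinarith [mul_le_mul_of_nonneg_left hθ hk0]
  have hcard : ∑ k ∈ Finset.Ico 1 τ, (1 : ℝ) = τ - 1 := by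
    simp [Nat.cast_sub hτ1]
  unfold rejectionCount
  linarith

/-- The reward of the rule is bounded from below by a gain from large means and three losses. -/
lemma reward_ruleTime_ge {γ a u q : ℝ} (hu : 0 < u) (hq : 0 < q) {k₀ m : ℕ} (hm : k₀ ≤ m)
    (hk : 1 ≤ k₀) (ω : ArmSpace) :
    m * q * ((Set.Icc (γ + q) (γ + 2 * q)).indicator 1 ω.1 * (survivalSet a u k₀).indicator 1 ω.2)
      - |ω.1 - γ| * rejectionCount a u k₀ ω.2
      - u * k₀ * (Set.Ici (γ - u + u / 4)).indicator 1 ω.1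
      - m * (max (γ - ω.1) 0 *
        {p : ArmSpace | k₀ * max (γ - p.1) 0 ≤ noiseSum k₀ p.2}.indicator 1 ω)
      ≤ (ω.1 - γ) * (ruleTime γ a u k₀ m ω : ℝ) := by
  set τ := ruleTime γ a u k₀ m ω with hτ
  have hτm : (τ : ℝ) ≤ m := by
    exact_mod_cast (isArmStoppingTime_ruleTime γ a u k₀ (hk.trans hm)).2 ω |>.2
  have hrej : 0 ≤ rejectionCount a u k₀ ω.2 := by
    unfold rejectionCount
    have : 0 ≤ ∑ k ∈ Finset.Ico 1 k₀, {ω : ℕ → ℝ | u / 4 * k - a ≤ noiseSum k ω}.indicator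
      (1 : (ℕ → ℝ) → ℝ) ω.2 := Finset.sum_nonneg fun k _ => Set.indicator_nonneg (by simp) _
    linarith
  have h2 : 0 ≤ |ω.1 - γ| * rejectionCount a u k₀ ω.2 := mul_nonneg (abs_nonneg _) hrej
  have h3 : 0 ≤ u * k₀ * (Set.Ici (γ - u + u / 4)).indicator (1 : ℝ → ℝ) ω.1 :=
    mul_nonneg (by positivity) (Set.indicator_nonneg (by simp) _)
  have h4 : 0 ≤ m * (max (γ - ω.1) 0 *
        {p : ArmSpace | k₀ * max (γ - p.1) 0 ≤ noiseSum k₀ p.2}.indicator (1 : ArmSpace → ℝ) ω) :=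
    mul_nonneg (by positivity) (mul_nonneg (le_max_right _ _) (Set.indicator_nonneg (by simp) _))
  rcases le_or_gt γ ω.1 with hθ | hθ
  · have hnn : 0 ≤ (ω.1 - γ) * (τ : ℝ) := mul_nonneg (by linarith) (by positivity)
    by_cases hJ : ω.1 ∈ Set.Icc (γ + q) (γ + 2 * q)
    · by_cases hE : ω.2 ∈ survivalSet a u k₀
      · have hτeq : τ = m := ruleTime_eq_of_mem_survivalSet hk (by linarith [hJ.1]) hE
        rw [Set.indicator_of_mem hJ, Set.indicator_of_mem hE, hτeq]
        have : (m : ℝ) * q ≤ (ω.1 - γ) * m := by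
          rw [mul_comm]
          exact mul_le_mul_of_nonneg_right (by linarith [hJ.1]) (by positivity)
        simp only [Pi.one_apply, mul_one]
        linarith
      · rw [Set.indicator_of_notMem hE]; linarith
    · rw [Set.indicator_of_notMem hJ]; linarith
  · have hJ : ω.1 ∉ Set.Icc (γ + q) (γ + 2 * q) := fun h => by linarith [h.1]
    rw [Set.indicator_of_notMem hJ]
    have habs : |ω.1 - γ| = γ - ω.1 := by rw [abs_of_neg (by linarith)]; ring
    have hmax : max (γ - ω.1) 0 = γ - ω.1 := max_eq_left (by linarith)
    -- For a mean below `γ` there are three losses: means at least `3 * u / 4` below are rejected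
    -- early, closer ones are played at most `k₀` times, and means that pass the test at `k₀` may be
    -- played `m` times.
    rcases le_or_gt (armSum γ k₀ ω) 0 with hW | hW
    · by_cases hfar : ω.1 - γ ≤ -(3 * u / 4)
      · have := ruleTime_le_rejectionCount (a := a) hm hk hfar hW
        rw [habs] at h2 ⊢
        nlinarith
      · have hmem : ω.1 ∈ Set.Ici (γ - u + u / 4) := by
          simp only [Set.mem_Ici]; linarith
        rw [Set.indicator_of_mem hmem] at h3 ⊢
        have hτk : (τ : ℝ) ≤ k₀ := by
          exact_mod_cast ruleTime_le hm hk hW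
        have h5 : (γ - ω.1) * (τ : ℝ) ≤ u * k₀ :=
          mul_le_mul (by linarith) hτk (by positivity) hu.le
        simp only [Pi.one_apply, mul_one] at *
        linarith
    · have hmem : ω ∈ {p : ArmSpace | k₀ * max (γ - p.1) 0 ≤ noiseSum k₀ p.2} := by
        simp only [Set.mem_ofPred_eq, hmax]
        rw [armSum_eq] at hW
        linarith
      rw [Set.indicator_of_mem hmem, hmax]
      simp only [Pi.one_apply, mul_one]
      nlinarith

/-- The geometric series without its zeroth term equals `1 / (exp c - 1)`. -/
lemma sum_exp_neg_mul_le {c : ℝ} (hc : 0 < c) (s : Finset ℕ) (hs : ∀ k ∈ s, 1 ≤ k) :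
    ∑ k ∈ s, Real.exp (-(c * k)) ≤ 1 / c := by
  have hlt : Real.exp (-c) < 1 := by rw [Real.exp_lt_one_iff]; linarith
  have hsum := summable_geometric_of_lt_one (Real.exp_pos (-c)).le hlt
  have heq : ∀ k : ℕ, Real.exp (-(c * k)) = Real.exp (-c) ^ k := fun k => by
    rw [← Real.exp_nat_mul]; ring_nf
  have h0 : (0 : ℕ) ∉ s := fun h => by simpa using hs 0 h
  have h1 : ∑ k ∈ insert 0 s, Real.exp (-c) ^ k ≤ ∑' k : ℕ, Real.exp (-c) ^ k :=
    hsum.sum_le_tsum _ fun k _ => by positivity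
  rw [Finset.sum_insert h0, tsum_geometric_of_lt_one (Real.exp_pos _).le hlt, pow_zero] at h1
  simp_rw [heq]
  have h2 : (1 - Real.exp (-c))⁻¹ ≤ 1 + 1 / c := by
    have h3 : 0 < 1 - Real.exp (-c) := by linarith
    have h4 : Real.exp (-c) * (1 + c) ≤ 1 := by
      rw [Real.exp_neg, inv_mul_le_one₀ (Real.exp_pos _)]
      linarith [Real.add_one_le_exp c]
    rw [inv_le_comm₀ h3 (by positivity)]
    have : (1 + 1 / c)⁻¹ = c / (1 + c) := by field_simp; ring
    rw [this, div_le_iff₀ (by linarith)]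
    linarith
  linarith

lemma integrable_rejectionCount (a u : ℝ) (k₀ : ℕ) :
    Integrable (rejectionCount a u k₀) noiseMeasure := by
  unfold rejectionCount
  refine (integrable_const _).add (integrable_finsetSum _ fun k _ => ?_)
  exact (integrable_const (1 : ℝ)).indicator
    (measurableSet_le measurable_const (measurable_noiseSum k))

/-- Chernoff's exponent `(u / 4 * k - a) ^ 2 / (2 * k)` is at least `u ^ 2 / 32 * k - 1 / 2`,
because the cross term is `a * u / 4 = 1 / 2`; the bounds then form a geometric series. -/
lemma integral_rejectionCount_le {a u : ℝ} (hu : 0 < u) (hau : a * u = 2) (k₀ : ℕ) :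
    ∫ ω, rejectionCount a u k₀ ω ∂noiseMeasure ≤ 1 + 64 / u ^ 2 := by
  have hmeas : ∀ k : ℕ, MeasurableSet {ω : ℕ → ℝ | u / 4 * k - a ≤ noiseSum k ω} := fun k =>
    measurableSet_le measurable_const (measurable_noiseSum k)
  have hi : ∀ k ∈ Finset.Ico 1 k₀, Integrable (fun ω =>
      {ω : ℕ → ℝ | u / 4 * k - a ≤ noiseSum k ω}.indicator (1 : (ℕ → ℝ) → ℝ) ω) noiseMeasure :=
    fun k _ => (integrable_const (1 : ℝ)).indicator (hmeas k)
  unfold rejectionCount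
  rw [integral_add (integrable_const _) (integrable_finsetSum _ hi), integral_finsetSum _ hi]
  simp only [integral_const, probReal_univ, smul_eq_mul, mul_one]
  have hterm : ∀ k ∈ Finset.Ico 1 k₀, ∫ ω, {ω : ℕ → ℝ | u / 4 * k - a ≤ noiseSum k ω}.indicator
      (1 : (ℕ → ℝ) → ℝ) ω ∂noiseMeasure ≤ 2 * Real.exp (-(u ^ 2 / 32 * k)) := by
    intro k hk
    have hk1 : 1 ≤ k := (Finset.mem_Ico.1 hk).1
    have hk' : (0 : ℝ) < k := by exact_mod_cast hk1
    rw [integral_indicator_one (hmeas k)]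
    have he : Real.exp (1 / 2) ≤ 2 := by
      have h1 : Real.exp (1 / 2) ^ 2 = Real.exp 1 := by rw [← Real.exp_nat_mul]; norm_num
      nlinarith [Real.exp_one_lt_d9, Real.exp_pos (1 / 2)]
    have h2 : Real.exp (1 / 2 - u ^ 2 / 32 * k) ≤ 2 * Real.exp (-(u ^ 2 / 32 * k)) := by
      rw [sub_eq_add_neg, Real.exp_add]
      exact mul_le_mul_of_nonneg_right he (Real.exp_pos _).le
    refine le_trans ?_ h2
    rcases le_total 0 (u / 4 * k - a) with hr | hr
    · refine (noiseMeasure_real_noiseSum_ge_le hk1 hr).trans (Real.exp_le_exp.2 ?_)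
      rw [div_le_iff₀ (by positivity)]
      nlinarith [sq_nonneg a]
    · refine measureReal_le_one.trans (Real.one_le_exp ?_)
      nlinarith
  refine add_le_add le_rfl ((Finset.sum_le_sum hterm).trans ?_)
  rw [← Finset.mul_sum]
  have := sum_exp_neg_mul_le (c := u ^ 2 / 32) (by positivity) (Finset.Ico 1 k₀)
    fun k hk => (Finset.mem_Ico.1 hk).1
  calc 2 * ∑ k ∈ Finset.Ico 1 k₀, Real.exp (-(u ^ 2 / 32 * k)) ≤ 2 * (1 / (u ^ 2 / 32)) := by
        linarith
    _ = 64 / u ^ 2 := by field_simp; norm_num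

/-- Replaces the probability of accepting a mean at distance `y` below `γ` by an exponential in `y`,
whose Gaussian integral is explicit. The proof uses `κ * y ≤ exp (κ * y)` and `2 * κ * y - κ ^ 2 * y
^ 2 / 2 ≤ 2`. -/
lemma mul_exp_neg_sq_le {κ s y : ℝ} (hκ : 0 < κ) (hs : s ≤ κ) (hy : 0 ≤ y) :
    y * Real.exp (-(κ ^ 2 * y ^ 2) / 2) ≤ 8 / κ * Real.exp (-(s * y)) := by
  have h1 : κ * y * Real.exp (-(κ ^ 2 * y ^ 2) / 2) ≤ 8 * Real.exp (-(s * y)) := by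
    calc κ * y * Real.exp (-(κ ^ 2 * y ^ 2) / 2)
        ≤ Real.exp (κ * y) * Real.exp (-(κ ^ 2 * y ^ 2) / 2) := by
          gcongr; linarith [Real.add_one_le_exp (κ * y)]
      _ ≤ Real.exp 2 * Real.exp (-(s * y)) := by
          rw [← Real.exp_add, ← Real.exp_add]
          apply Real.exp_le_exp.2
          nlinarith [sq_nonneg (κ * y - 2), mul_le_mul_of_nonneg_right hs hy]
      _ ≤ 8 * Real.exp (-(s * y)) := by
          gcongr
          have : Real.exp 2 = Real.exp 1 ^ 2 := by rw [← Real.exp_nat_mul]; norm_num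
          rw [this]; nlinarith [Real.exp_one_lt_d9, Real.exp_pos 1]
  rw [div_mul_eq_mul_div, le_div_iff₀ hκ]
  linarith

/-- The loss of the rule from means below `γ` that pass the test. -/
lemma integral_acceptance_loss_le (ν : ℝ) {v : ℝ≥0} {σ x κ : ℝ} (hσ : 0 < σ)
    (hv : (v : ℝ) = σ ^ 2) {k₀ : ℕ} (hk : 1 ≤ k₀) (hκ : 0 < κ)
    (hκk : κ ^ 2 ≤ k₀) (hs : x / σ ≤ κ) :
    Integrable (fun ω : ArmSpace => max ((ν + σ * x) - ω.1) 0 *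
        {p : ArmSpace | k₀ * max ((ν + σ * x) - p.1) 0 ≤ noiseSum k₀ p.2}.indicator 1 ω)
        (armMeasure ν v) ∧
    ∫ ω, max ((ν + σ * x) - ω.1) 0 *
        {p : ArmSpace | k₀ * max ((ν + σ * x) - p.1) 0 ≤ noiseSum k₀ p.2}.indicator 1 ω
        ∂armMeasure ν v ≤ 8 / κ * Real.exp (-(x ^ 2) / 2) := by
  set γ := ν + σ * x with hγ
  have hmeas : MeasurableSet {p : ArmSpace | k₀ * max (γ - p.1) 0 ≤ noiseSum k₀ p.2} := by
    refine measurableSet_le (by fun_prop) ((measurable_noiseSum k₀).comp measurable_snd)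
  have hint : Integrable (fun ω : ArmSpace => max (γ - ω.1) 0 *
        {p : ArmSpace | k₀ * max (γ - p.1) 0 ≤ noiseSum k₀ p.2}.indicator 1 ω)
        (armMeasure ν v) := by
    have h1 : Integrable (fun ω : ArmSpace => max (γ - ω.1) 0) (armMeasure ν v) :=
      integrable_armMeasure_fst (f := fun z => max (γ - z) 0)
        ((integrable_const γ).sub (integrable_id_gaussianReal ν v)).pos_part
    refine h1.mul_bdd (c := 1) (measurable_one.indicator hmeas).aestronglyMeasurable
      (ae_of_all _ fun ω => ?_)
    by_cases h : ω ∈ {p : ArmSpace | k₀ * max (γ - p.1) 0 ≤ noiseSum k₀ p.2}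
    · simp [Set.indicator_of_mem h]
    · simp [Set.indicator_of_notMem h]
  refine ⟨hint, ?_⟩
  rw [armMeasure_eq] at hint ⊢
  rw [integral_prod _ hint]
  calc ∫ z, ∫ w, max (γ - z) 0 * {p : ArmSpace | k₀ * max (γ - p.1) 0 ≤ noiseSum k₀ p.2}.indicator
        1 (z, w) ∂noiseMeasure ∂gaussianReal ν v
      ≤ ∫ z, 8 / κ * Real.exp (x / σ * (z - γ)) ∂gaussianReal ν v := by
        refine integral_mono hint.integral_prod_left
          ((integrable_exp_mul_sub_gaussianReal ν v (x / σ) γ).const_mul _) fun z => ?_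
        simp only
        set y := max (γ - z) 0 with hy
        have hy0 : 0 ≤ y := le_max_right _ _
        have e1 : ∀ w : ℕ → ℝ, {p : ArmSpace | k₀ * max (γ - p.1) 0 ≤ noiseSum k₀ p.2}.indicator
            (1 : ArmSpace → ℝ) (z, w)
            = {w : ℕ → ℝ | k₀ * y ≤ noiseSum k₀ w}.indicator (1 : (ℕ → ℝ) → ℝ) w := by
          intro w; simp only [Set.indicator, Set.mem_ofPred_eq, ← hy]; rfl
        simp_rw [e1]
        rw [integral_const_mul, integral_indicator_one
          (measurableSet_le measurable_const (measurable_noiseSum k₀))]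
        rcases le_total (γ - z) 0 with hz | hz
        · have : y = 0 := max_eq_right hz
          rw [this, zero_mul]; positivity
        · have hyz : y = γ - z := max_eq_left hz
          have hk' : (0 : ℝ) < k₀ := by exact_mod_cast hk
          have h1 := noiseMeasure_real_noiseSum_ge_le hk (r := k₀ * y) (by positivity)
          have h2 : Real.exp (-(k₀ * y) ^ 2 / (2 * k₀)) ≤ Real.exp (-(κ ^ 2 * y ^ 2) / 2) := by
            apply Real.exp_le_exp.2
            have : -((k₀ : ℝ) * y) ^ 2 / (2 * k₀) = -(k₀ * y ^ 2) / 2 := by field_simp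
            rw [this]
            have := mul_le_mul_of_nonneg_right hκk (sq_nonneg y)
            linarith
          have h3 := mul_exp_neg_sq_le hκ hs hy0
          have h4 : x / σ * (z - γ) = -(x / σ * y) := by rw [hyz]; ring
          rw [h4]
          exact (mul_le_mul_of_nonneg_left (h1.trans h2) hy0).trans h3
    _ = _ := by
        rw [integral_const_mul, hγ, integral_exp_tilt_gaussianReal ν hσ hv x]

lemma integral_abs_sub_gaussianReal_le_add (ν γ : ℝ) {σ : ℝ} (hσ : 0 < σ) {v : ℝ≥0}
    (hv : (v : ℝ) = σ ^ 2) : ∫ z, |z - γ| ∂gaussianReal ν v ≤ σ + |ν - γ| := by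
  have i1 : ∀ c, Integrable (fun z : ℝ => |z - c|) (gaussianReal ν v) := fun c =>
    ((integrable_id_gaussianReal ν v).sub (integrable_const c)).abs
  calc ∫ z, |z - γ| ∂gaussianReal ν v ≤ ∫ z, (|z - ν| + |ν - γ|) ∂gaussianReal ν v :=
        integral_mono (i1 γ) ((i1 ν).add (integrable_const _)) fun z => abs_sub_le z ν γ
    _ = ∫ z, |z - ν| ∂gaussianReal ν v + |ν - γ| := by
        rw [integral_add (i1 ν) (integrable_const _)]; simp
    _ ≤ σ + |ν - γ| := by
        have := integral_abs_sub_gaussianReal_le ν hσ hv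
        linarith

/-- A lower bound for the value of the rule. -/
lemma integral_reward_ruleTime_ge (ν : ℝ) {v : ℝ≥0} {σ x κ : ℝ} (hσ : 0 < σ)
    (hv : (v : ℝ) = σ ^ 2) (hx : 1 ≤ x) {k₀ m : ℕ} (hk : 1 ≤ k₀) (hm : k₀ ≤ m) (hκ : 0 < κ)
    (hκk : κ ^ 2 ≤ k₀) (hs : x / σ ≤ κ) :
    m * (σ / x) * (Real.exp (-(x ^ 2) / 2) / x / 400 * (1 / 3))
      - 2 * (σ * x) * (1 + 64 / (σ * x) ^ 2)
      - σ * x * k₀ * Real.exp (-(x ^ 2) / 32)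
      - m * (8 / κ * Real.exp (-(x ^ 2) / 2))
      ≤ ∫ ω, (ω.1 - (ν + σ * x)) * (ruleTime (ν + σ * x) (2 / (σ * x)) (σ * x) k₀ m ω : ℝ)
        ∂armMeasure ν v := by
  have hx0 : 0 < x := by linarith
  set γ := ν + σ * x with hγ
  set u := σ * x with hu
  have hu0 : 0 < u := by positivity
  set a := 2 / u with ha
  have hau : a * u = 2 := by rw [ha]; field_simp
  have hv0 : v ≠ 0 := by
    rintro rfl
    exact (pow_pos hσ 2).ne (by simpa using hv)
  obtain ⟨i4, e4⟩ := integral_acceptance_loss_le (x := x) ν hσ hv hk hκ hκk hs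
  rw [← hγ] at i4 e4
  set J := Set.Icc (γ + σ / x) (γ + 2 * (σ / x)) with hJ
  set E := survivalSet a u k₀ with hE
  have hEm : MeasurableSet E := measurableSet_survivalSet a u k₀
  have iJ : Integrable (J.indicator (1 : ℝ → ℝ)) (gaussianReal ν v) :=
    (integrable_const (1 : ℝ)).indicator measurableSet_Icc
  have iE : Integrable (E.indicator (1 : (ℕ → ℝ) → ℝ)) noiseMeasure :=
    (integrable_const (1 : ℝ)).indicator hEm
  have iabs : Integrable (fun z : ℝ => |z - γ|) (gaussianReal ν v) :=
    ((integrable_id_gaussianReal ν v).sub (integrable_const γ)).abs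
  have i1 : Integrable (fun ω : ArmSpace => J.indicator (1 : ℝ → ℝ) ω.1
      * E.indicator (1 : (ℕ → ℝ) → ℝ) ω.2) (armMeasure ν v) := by
    rw [armMeasure_eq]; exact iJ.mul_prod iE
  have e1 : ∫ ω, J.indicator (1 : ℝ → ℝ) ω.1 * E.indicator (1 : (ℕ → ℝ) → ℝ) ω.2 ∂armMeasure ν v
      = (gaussianReal ν v).real J * noiseMeasure.real E := by
    rw [armMeasure_eq, integral_prod_mul, integral_indicator_one measurableSet_Icc,
      integral_indicator_one hEm]
  have i2 : Integrable (fun ω : ArmSpace => |ω.1 - γ| * rejectionCount a u k₀ ω.2)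
      (armMeasure ν v) := by
    rw [armMeasure_eq]; exact iabs.mul_prod (integrable_rejectionCount a u k₀)
  have e2 : ∫ ω, |ω.1 - γ| * rejectionCount a u k₀ ω.2 ∂armMeasure ν v
      = (∫ z, |z - γ| ∂gaussianReal ν v) * ∫ w, rejectionCount a u k₀ w ∂noiseMeasure := by
    rw [armMeasure_eq, integral_prod_mul (fun z : ℝ => |z - γ|)]
  have i3 : Integrable (fun ω : ArmSpace => (Set.Ici (γ - u + u / 4)).indicator (1 : ℝ → ℝ) ω.1)
      (armMeasure ν v) :=
    integrable_armMeasure_fst ((integrable_const (1 : ℝ)).indicator measurableSet_Ici)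
  have e3 : ∫ ω, (Set.Ici (γ - u + u / 4)).indicator (1 : ℝ → ℝ) ω.1 ∂armMeasure ν v
      = (gaussianReal ν v).real (Set.Ici (γ - u + u / 4)) := by
    rw [integral_armMeasure_fst ν v, integral_indicator_one measurableSet_Ici]
  have hmono := integral_mono
    ((((i1.const_mul (m * (σ / x))).sub i2).sub (i3.const_mul (u * k₀))).sub (i4.const_mul m))
    ((isArmStoppingTime_ruleTime γ a u k₀ (hk.trans hm)).integrable ν v γ)
    (fun ω => reward_ruleTime_ge (a := a) hu0 (by positivity : 0 < σ / x) hm hk ω)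
  refine le_trans ?_ hmono
  rw [integral_sub' (((i1.const_mul _).sub i2).sub (i3.const_mul _)) (i4.const_mul _),
    integral_sub' ((i1.const_mul _).sub i2) (i3.const_mul _),
    integral_sub' (i1.const_mul _) i2, integral_const_mul, integral_const_mul, integral_const_mul,
    e1, e2, e3]
  have b1 : Real.exp (-(x ^ 2) / 2) / x / 400 * (1 / 3)
      ≤ (gaussianReal ν v).real J * noiseMeasure.real E :=
    mul_le_mul (le_gaussianReal_real_Icc ν hσ hx hv) (third_le_survivalSet hu0.le hau k₀)
      (by norm_num) measureReal_nonneg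
  have b1' : m * (σ / x) * (Real.exp (-(x ^ 2) / 2) / x / 400 * (1 / 3))
      ≤ m * (σ / x) * ((gaussianReal ν v).real J * noiseMeasure.real E) :=
    mul_le_mul_of_nonneg_left b1 (by positivity)
  have b2 : (∫ z, |z - γ| ∂gaussianReal ν v) * ∫ w, rejectionCount a u k₀ w ∂noiseMeasure
      ≤ 2 * u * (1 + 64 / u ^ 2) := by
    have hrej := integral_rejectionCount_le hu0 hau k₀
    have habs : ∫ z, |z - γ| ∂gaussianReal ν v ≤ 2 * u := by
      -- The bound is `σ + u`, and `σ ≤ u` because `x ≥ 1`.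
      refine (integral_abs_sub_gaussianReal_le_add ν γ hσ hv).trans ?_
      have : |ν - γ| = u := by rw [hγ, sub_add_cancel_left, abs_neg, abs_of_pos hu0]
      rw [this]
      nlinarith
    calc _ ≤ (∫ z, |z - γ| ∂gaussianReal ν v) * (1 + 64 / u ^ 2) :=
          mul_le_mul_of_nonneg_left hrej (integral_nonneg fun z => abs_nonneg _)
      _ ≤ _ := mul_le_mul_of_nonneg_right habs (by positivity)
  have b3 : u * k₀ * (gaussianReal ν v).real (Set.Ici (γ - u + u / 4))
      ≤ u * k₀ * Real.exp (-(x ^ 2) / 32) := by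
    apply mul_le_mul_of_nonneg_left _ (by positivity)
    -- Since `u` is the distance from `ν` to `γ`, means this close to `γ` are themselves `u / 4 = σ
    -- * x / 4` above the prior mean.
    have e : γ - u + u / 4 = ν + u / 4 := by rw [hγ]; ring
    rw [e]
    refine (gaussianReal_real_Ici_le ν hv0 (r := u / 4) (by positivity)).trans (le_of_eq ?_)
    congr 1
    rw [hv, hu]; field_simp; norm_num
  have b4 := mul_le_mul_of_nonneg_left e4 (Nat.cast_nonneg (α := ℝ) m)
  linarith

lemma pow_six_le_exp {x : ℝ} : x ^ 6 ≤ 196608 * Real.exp (x ^ 2 / 32) := by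
  have h := Real.pow_div_factorial_le_exp (x := x ^ 2 / 32) (by positivity) 3
  have e : (x ^ 2 / 32) ^ 3 / (Nat.factorial 3 : ℕ) = x ^ 6 / 196608 := by
    norm_num [Nat.factorial]; ring
  rw [e, div_le_iff₀ (by norm_num)] at h
  linarith

/-- The Gittins index of an arm with posterior variance `1 / T` and `m` rounds to go exceeds the
posterior mean by `x / √T` if `m` is at least a multiple of `exp (x ^ 2 / 2) * x * (T + x ^ 2)`. -/
theorem exists_add_div_sqrt_le_gittinsIndex :
    ∃ C : ℝ, 1 ≤ C ∧ ∀ (ν : ℝ) (T m : ℕ) (x : ℝ), 1 ≤ T → 1 ≤ x →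
      C * (Real.exp (x ^ 2 / 2) * (x * (T + x ^ 2))) ≤ m →
      ν + x / √T ≤ gittinsIndex ν (T : ℝ≥0)⁻¹ m := by
  obtain ⟨K, hK⟩ : ∃ K : ℝ, K = 19200 ^ 2 := ⟨_, rfl⟩
  have hK1 : 1 ≤ K := by rw [hK]; norm_num
  refine ⟨2400 * (128 + 2 * K * 196608), by nlinarith, fun ν T m x hT hx hm => ?_⟩
  have hT' : (1 : ℝ) ≤ T := by exact_mod_cast hT
  have hx0 : 0 < x := by linarith
  set s := √(T : ℝ) with hs
  have hs2 : s ^ 2 = T := Real.sq_sqrt (by positivity)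
  have hs1 : 1 ≤ s := by rw [hs]; exact Real.one_le_sqrt.2 hT'
  have hs0 : 0 < s := by linarith
  set σ := 1 / s with hσdef
  have hσ : 0 < σ := by positivity
  have hv : (((T : ℝ≥0)⁻¹ : ℝ≥0) : ℝ) = σ ^ 2 := by
    rw [hσdef, div_pow, hs2]; simp
  have hv0 : ((T : ℝ≥0)⁻¹ : ℝ≥0) ≠ 0 := by
    have : (T : ℝ≥0) ≠ 0 := by positivity
    exact inv_ne_zero this
  -- With this `κ` the acceptance loss `8 / κ = σ / (2400 * x ^ 2)` is half of the gain `σ / (1200 *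
  -- x ^ 2)`, both up to the factor `m * exp (-(x ^ 2) / 2)`. The test length `k₀` is then of order
  -- `x ^ 4 * T`.
  set κ := 19200 * x ^ 2 / σ with hκ
  have hκ0 : 0 < κ := by positivity
  have hκ2 : κ ^ 2 = K * x ^ 4 * T := by
    rw [hκ, hK, hσdef, ← hs2]; field_simp
  have hκ1 : 1 ≤ κ ^ 2 := by
    rw [hκ2]
    have : 1 ≤ x ^ 4 := one_le_pow₀ hx
    calc (1 : ℝ) = 1 * 1 * 1 := by ring
      _ ≤ K * x ^ 4 * T := by gcongr
  set k₀ := ⌈κ ^ 2⌉₊ with hk₀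
  have hk1 : 1 ≤ k₀ := Nat.one_le_ceil_iff.2 (by positivity)
  have hkle : κ ^ 2 ≤ k₀ := Nat.le_ceil _
  have hkge : (k₀ : ℝ) ≤ 2 * (K * x ^ 4 * T) := by
    have := (Nat.ceil_lt_add_one (by positivity : 0 ≤ κ ^ 2)).le
    rw [← hk₀] at this
    linarith
  have hexp : x ^ 3 ≤ 8 * Real.exp (x ^ 2 / 2) := by
    have h := Real.quadratic_le_exp_of_nonneg (x := x ^ 2 / 2) (by positivity)
    have : x ^ 3 ≤ x ^ 4 := pow_le_pow_right₀ hx (by norm_num)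
    nlinarith
  have hkm : k₀ ≤ m := by
    have : (k₀ : ℝ) ≤ m := by
      refine hkge.trans (le_trans ?_ hm)
      have hE := Real.exp_pos (x ^ 2 / 2)
      calc 2 * (K * x ^ 4 * T) = 2 * K * (x * T) * x ^ 3 := by ring
        _ ≤ 2 * K * (x * T) * (8 * Real.exp (x ^ 2 / 2)) := by gcongr
        _ = (16 * K) * (Real.exp (x ^ 2 / 2) * (x * T)) := by ring
        _ ≤ 2400 * (128 + 2 * K * 196608) * (Real.exp (x ^ 2 / 2) * (x * (T + x ^ 2))) := by
            gcongr
            · nlinarith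
            · nlinarith
            · exact le_add_of_nonneg_right (sq_nonneg x)
    exact_mod_cast this
  have hval := integral_reward_ruleTime_ge ν hσ hv hx hk1 hkm hκ0 hkle (by
    rw [hκ]; gcongr; nlinarith)
  have hmain : 0 ≤ m * (σ / x) * (Real.exp (-(x ^ 2) / 2) / x / 400 * (1 / 3))
      - 2 * (σ * x) * (1 + 64 / (σ * x) ^ 2)
      - σ * x * k₀ * Real.exp (-(x ^ 2) / 32)
      - m * (8 / κ * Real.exp (-(x ^ 2) / 2)) := by
    set u := σ * x with hu
    have hu0 : 0 < u := by positivity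
    have g1 : m * (σ / x) * (Real.exp (-(x ^ 2) / 2) / x / 400 * (1 / 3))
        - m * (8 / κ * Real.exp (-(x ^ 2) / 2))
        = m * (σ * Real.exp (-(x ^ 2) / 2) / x ^ 2) / 2400 := by
      rw [hκ]; field_simp; ring
    -- This is the hypothesis on `m` rewritten with `T + x ^ 2 = (1 + u ^ 2) / σ ^ 2`. The two
    -- remaining losses are also at most multiples of `u + 1 / u`.
    have g2 : 2400 * (128 + 2 * K * 196608) * ((1 + u ^ 2) / u)
        ≤ m * (σ * Real.exp (-(x ^ 2) / 2) / x ^ 2) := by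
      calc 2400 * (128 + 2 * K * 196608) * ((1 + u ^ 2) / u)
          = 2400 * (128 + 2 * K * 196608) * (Real.exp (x ^ 2 / 2) * (x * (T + x ^ 2)))
            * (σ * Real.exp (-(x ^ 2) / 2) / x ^ 2) := by
            have he : Real.exp (-(x ^ 2) / 2) = (Real.exp (x ^ 2 / 2))⁻¹ := by
              rw [← Real.exp_neg]; congr 1; ring
            have hE := Real.exp_pos (x ^ 2 / 2)
            rw [he, hu, hσdef, ← hs2]
            field_simp
        _ ≤ _ := by gcongr
    have g3 : u * k₀ * Real.exp (-(x ^ 2) / 32) ≤ 2 * K * 196608 / u := by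
      have he : Real.exp (-(x ^ 2) / 32) = (Real.exp (x ^ 2 / 32))⁻¹ := by
        rw [← Real.exp_neg]; congr 1; ring
      have hE := Real.exp_pos (x ^ 2 / 32)
      calc u * k₀ * Real.exp (-(x ^ 2) / 32)
          ≤ u * (2 * (K * x ^ 4 * T)) * Real.exp (-(x ^ 2) / 32) := by gcongr
        _ = 2 * K / u * x ^ 6 * Real.exp (-(x ^ 2) / 32) := by
            rw [hu, hσdef, ← hs2]; field_simp
        _ ≤ 2 * K / u * (196608 * Real.exp (x ^ 2 / 32)) * Real.exp (-(x ^ 2) / 32) := by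
            gcongr
            exact pow_six_le_exp
        _ = 2 * K * 196608 / u := by rw [he]; field_simp
    have g4 : 2 * u * (1 + 64 / u ^ 2) = 2 * u + 128 / u := by field_simp; ring
    have g5 : (1 + u ^ 2) / u = u + 1 / u := by field_simp; ring
    rw [g5] at g2
    have g6 : 2 * K * 196608 / u = 2 * K * 196608 * (1 / u) := by ring
    have g7 : (128 : ℝ) / u = 128 * (1 / u) := by ring
    have hiu : 0 < 1 / u := by positivity
    rw [g4]
    nlinarith
  have hfin := le_gittinsIndex_of_isArmStoppingTime hv0 (hk1.trans hkm)
    (isArmStoppingTime_ruleTime (ν + σ * x) (2 / (σ * x)) (σ * x) k₀ (hk1.trans hkm))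
    (hmain.trans hval)
  have e : x / s = σ * x := by rw [hσdef]; ring
  rw [e]; exact hfin

/-! ### Elementary inequalities for the index boundary -/

/-- Half the square of the boundary: an arm with `T` plays and `m = A * T * exp L` rounds to go has
an index that exceeds its mean by about `√(2 * halfSq L T / T)`. -/
def halfSq (L T : ℝ) : ℝ := L - Real.log L / 2 - Real.log (1 + L / T)

/-- The tangent to the logarithm at `8`. -/
lemma log_le_div_eight {z : ℝ} (hz : 0 < z) : Real.log z ≤ z / 8 + 5 / 4 := by
  have h := Real.log_le_sub_one_of_pos (by positivity : 0 < z / 8)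
  rw [Real.log_div hz.ne' (by norm_num)] at h
  have h8 : Real.log 8 = 3 * Real.log 2 := by
    rw [show (8 : ℝ) = 2 ^ 3 by norm_num, Real.log_pow]; norm_num
  have := Real.log_two_lt_d9
  linarith

lemma halfSq_ge {L T : ℝ} (hL : 20 ≤ L) (hT : 1 ≤ T) : L / 2 + 3 ≤ halfSq L T := by
  have h1 := log_le_div_eight (by linarith : 0 < L)
  have h2 : Real.log (1 + L / T) ≤ Real.log (1 + L) := by
    apply Real.log_le_log (by positivity)
    have : L / T ≤ L := div_le_self (by linarith) hT
    linarith
  have h3 := log_le_div_eight (by linarith : 0 < 1 + L)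
  unfold halfSq
  linarith

lemma halfSq_le {L T : ℝ} (hL : 1 ≤ L) (hT : 0 < T) : halfSq L T ≤ L := by
  have h1 := Real.log_nonneg hL
  have h2 : 0 ≤ Real.log (1 + L / T) :=
    Real.log_nonneg (by have : 0 < L / T := by positivity
                        linarith)
  unfold halfSq
  linarith

/-- The corrections in `halfSq` are chosen for this identity: with `x ^ 2 = 2 * halfSq L T`, which
lies between `L` and `2 * L` for large `L`, the factor `x * (T + x ^ 2)` is of the order of the
denominator, and `exp (x ^ 2 / 2) * x * (T + x ^ 2)` is of order `exp L * T`. -/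
lemma exp_halfSq {L T : ℝ} (hL : 0 < L) (hT : 0 < T) :
    Real.exp (halfSq L T) = Real.exp L * T / (√L * (T + L)) := by
  unfold halfSq
  rw [Real.exp_sub, Real.exp_sub, Real.exp_log (by positivity), Real.exp_half, Real.exp_log hL]
  have : 0 < √L := Real.sqrt_pos.2 hL
  field_simp

/-- The boundary satisfies the condition for the lower bound on the index. -/
lemma exp_halfSq_mul_le {L T : ℝ} (hL : 20 ≤ L) (hT : 1 ≤ T) :
    Real.exp (√(2 * halfSq L T) ^ 2 / 2) * (√(2 * halfSq L T) * (T + √(2 * halfSq L T) ^ 2))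
      ≤ 3 * (Real.exp L * T) := by
  have hge := halfSq_ge hL hT
  have hle := halfSq_le (by linarith : 1 ≤ L) (by linarith : 0 < T)
  rw [Real.sq_sqrt (by linarith), mul_div_cancel_left₀ _ (by norm_num : (2 : ℝ) ≠ 0),
    exp_halfSq (by linarith) (by linarith)]
  have hL0 : 0 < √L := Real.sqrt_pos.2 (by linarith)
  have hs : √(2 * halfSq L T) ≤ 3 / 2 * √L := by
    rw [show (3 / 2 : ℝ) = √(9 / 4) by
      rw [show (9 / 4 : ℝ) = (3 / 2) ^ 2 by norm_num, Real.sqrt_sq (by norm_num)],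
      ← Real.sqrt_mul (by norm_num)]
    exact Real.sqrt_le_sqrt (by linarith)
  have hT0 : 0 < T := by linarith
  calc Real.exp L * T / (√L * (T + L)) * (√(2 * halfSq L T) * (T + 2 * halfSq L T))
      ≤ Real.exp L * T / (√L * (T + L)) * (3 / 2 * √L * (2 * (T + L))) := by
        gcongr <;> linarith
    _ = 3 * (Real.exp L * T) := by field_simp

/-- The boundary hardly changes over a block of `T / L` plays. -/
lemma halfSq_block_le {L L' T k : ℝ} (hL' : 20 ≤ L') (hT : 1 ≤ T) (hLL : L' ≤ L) (hLL1 : L ≤ L' + 1)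
    (hTk : T ≤ k) (hk2 : k ≤ 2 * T) : halfSq L' k - 2 ≤ halfSq L T := by
  have h2 := Real.log_two_lt_d9
  have h1 : Real.log L ≤ Real.log 2 + Real.log L' := by
    rw [← Real.log_mul (by norm_num) (by linarith)]
    exact Real.log_le_log (by linarith) (by linarith)
  have h3 : Real.log (1 + L / T) ≤ 2 * Real.log 2 + Real.log (1 + L' / k) := by
    have hk : 0 < k := by linarith
    have hp : 0 < 1 + L' / k := by
      have : 0 < L' / k := div_pos (by linarith) hk
      linarith
    have : 2 * Real.log 2 + Real.log (1 + L' / k) = Real.log (4 * (1 + L' / k)) := by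
      rw [Real.log_mul (by norm_num) hp.ne', show (4 : ℝ) = 2 ^ 2 by norm_num, Real.log_pow]
      norm_num
    rw [this]
    have hLT : 0 < L / T := div_pos (by linarith) (by linarith)
    apply Real.log_le_log (by linarith)
    have h4 : L / T ≤ 4 * (L' / k) := by
      rw [← mul_div_assoc, div_le_div_iff₀ (by linarith) hk]
      nlinarith [mul_le_mul hk2 (by linarith : L ≤ 2 * L') (by linarith) (by linarith)]
    linarith
  unfold halfSq
  linarith

/-- The room for this is the halved slope and the `3` subtracted from `halfSq`. Of the latter, `2`
covers the change of `halfSq` over the block, and `1` covers the longer time, since `L * (T / L) =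
T`; the slope suffices because `k ≤ 2 * T`. -/
lemma boundary_block_le {L L' T k ε : ℝ} (hL' : 20 ≤ L') (hT : 1 ≤ T) (hLL : L' ≤ L)
    (hLL1 : L ≤ L' + 1) (hTk : T ≤ k) (hk : k ≤ T + T / L) (hε : 0 ≤ ε) :
    ε * k / 2 + √(2 * (halfSq L' k - 3)) * √k ≤ ε * T + √(2 * halfSq L T) * √T := by
  have hL0 : 0 < L := by linarith
  have hTL : T / L ≤ T := div_le_self (by linarith) (by linarith)
  have hk2 : k ≤ 2 * T := by linarith
  have h1 := halfSq_block_le hL' hT hLL hLL1 hTk hk2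
  have h2 := halfSq_ge hL' (hT.trans hTk)
  have h3 := halfSq_le (by linarith : 1 ≤ L') (by linarith : 0 < k)
  have h4 : √(2 * (halfSq L' k - 3)) * √k ≤ √(2 * halfSq L T) * √T := by
    rw [← Real.sqrt_mul (by linarith), ← Real.sqrt_mul (by linarith)]
    apply Real.sqrt_le_sqrt
    have h5 : halfSq L' k - 3 ≤ L := by linarith
    have h6 : (halfSq L' k - 3) * k ≤ (halfSq L' k - 3) * (T + T / L) :=
      mul_le_mul_of_nonneg_left hk (by linarith)
    have h7 : (halfSq L' k - 3) * (T / L) ≤ L * (T / L) :=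
      mul_le_mul_of_nonneg_right h5 (by positivity)
    have h8 : L * (T / L) = T := by field_simp
    nlinarith
  nlinarith

/-- If `T ≥ L`, the block has at least `T / L` members, each contributing at least `L / T`. If `T <
L`, its first member alone suffices. -/
lemma one_le_block_sum {T : ℕ} {L : ℝ} (hT : 1 ≤ T) (hL : 21 ≤ L) {f : ℕ → ℝ}
    (hf1 : ∀ k ∈ Finset.Icc T (T + ⌊T / L⌋₊), 20 ≤ f k ∧ f k ≤ L ∧ L ≤ f k + 1) :
    1 ≤ ∑ k ∈ Finset.Icc T (T + ⌊T / L⌋₊), 16 * f k / (k + f k) / 2 := by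
  have hT' : (1 : ℝ) ≤ T := by exact_mod_cast hT
  have hL0 : 0 < L := by linarith
  rcases lt_or_ge (T : ℝ) L with hlt | hge
  · have hmem : T ∈ Finset.Icc T (T + ⌊T / L⌋₊) := by simp
    obtain ⟨h1, h2, h3⟩ := hf1 T hmem
    refine le_trans ?_ (Finset.single_le_sum (f := fun k : ℕ => 16 * f k / (k + f k) / 2)
      (fun k hk => ?_) hmem)
    · rw [div_div, le_div_iff₀ (by linarith)]
      linarith
    · have := (hf1 k hk).1
      positivity
  · have hterm : ∀ k ∈ Finset.Icc T (T + ⌊T / L⌋₊), L / T ≤ 16 * f k / (k + f k) / 2 := by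
      intro k hk
      obtain ⟨h1, h2, h3⟩ := hf1 k hk
      obtain ⟨hk1, hk2⟩ := Finset.mem_Icc.1 hk
      have hk2' : (k : ℝ) ≤ T + T / L := by
        have h4 : (k : ℝ) ≤ T + (⌊T / L⌋₊ : ℕ) := by exact_mod_cast hk2
        have := Nat.floor_le (by positivity : 0 ≤ T / L)
        linarith
      have hTL : T / L ≤ T := div_le_self (by linarith) (by linarith)
      rw [div_div, div_le_div_iff₀ (by linarith) (by positivity)]
      have h5 : (k : ℝ) + f k ≤ 3 * T := by linarith
      nlinarith
    have hcard : (T : ℝ) / L ≤ (Finset.Icc T (T + ⌊T / L⌋₊)).card := by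
      rw [Nat.card_Icc]
      have := (Nat.lt_floor_add_one (T / L)).le
      have e : T + ⌊T / L⌋₊ + 1 - T = ⌊T / L⌋₊ + 1 := by omega
      rw [e]; push_cast; exact this
    calc (1 : ℝ) = T / L * (L / T) := by field_simp
      _ ≤ (Finset.Icc T (T + ⌊T / L⌋₊)).card * (L / T) := by gcongr
      _ = ∑ k ∈ Finset.Icc T (T + ⌊T / L⌋₊), L / T := by simp
      _ ≤ _ := Finset.sum_le_sum hterm

/-! ### Summation of the crossing probabilities -/

lemma exp_neg_le_inv_sq {z : ℝ} (hz : 0 ≤ z) : Real.exp (-z) ≤ 24 / (1 + z ^ 2) ^ 2 := by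
  rw [le_div_iff₀ (by positivity), Real.exp_neg, inv_mul_le_iff₀ (Real.exp_pos _)]
  have h : 1 + z + z ^ 2 / 2 + z ^ 3 / 6 + z ^ 4 / 24 ≤ Real.exp z := by
    simpa [Finset.sum_range_succ, Nat.factorial] using Real.sum_le_exp_of_nonneg hz 5
  nlinarith [pow_nonneg hz 3, pow_nonneg hz 2]

lemma sum_inv_sq_le {c : ℝ} (hc : 0 < c) (n : ℕ) :
    ∑ k ∈ Finset.Icc 1 n, 1 / (1 + c * k) ^ 2 ≤ 1 / c := by
  have h : ∑ k ∈ Finset.Icc 1 n, 1 / (1 + c * (k : ℝ)) ^ 2 ≤ 1 / c - 1 / (c * (1 + c * n)) := by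
    induction n with
    | zero => simp
    | succ n ih =>
      rw [Finset.sum_Icc_succ_top (by omega)]
      have h1 : 1 / (1 + c * ((n + 1 : ℕ) : ℝ)) ^ 2
          ≤ 1 / (c * (1 + c * n)) - 1 / (c * (1 + c * ((n + 1 : ℕ) : ℝ))) := by
        push_cast
        have e : 1 / (c * (1 + c * n)) - 1 / (c * (1 + c * ((n : ℝ) + 1)))
            = 1 / ((1 + c * n) * (1 + c * (n + 1))) := by
          field_simp; ring
        rw [e]
        apply one_div_le_one_div_of_le (by positivity)
        rw [sq]
        gcongr
        linarith
      linarith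
  have : 0 ≤ 1 / (c * (1 + c * n)) := by positivity
  linarith

lemma sum_inv_sqrt_le (n : ℕ) : ∑ k ∈ Finset.Icc 1 n, 1 / √k ≤ 2 * √n := by
  induction n with
  | zero => simp
  | succ n ih =>
    rw [Finset.sum_Icc_succ_top (by omega)]
    have h1 : 1 / √((n + 1 : ℕ) : ℝ) ≤ 2 * √((n + 1 : ℕ) : ℝ) - 2 * √n := by
      have hp : 0 < √((n + 1 : ℕ) : ℝ) := Real.sqrt_pos.2 (by positivity)
      rw [div_le_iff₀ hp]
      have h2 : √((n + 1 : ℕ) : ℝ) ^ 2 = n + 1 := by rw [Real.sq_sqrt (by positivity)]; push_cast; rfl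
      have h3 : √(n : ℝ) ^ 2 = n := Real.sq_sqrt (by positivity)
      nlinarith [sq_nonneg (√((n + 1 : ℕ) : ℝ) - √n)]
    linarith

/-- Here `s` stands for `ε ^ 2 * k`. For `s ≤ 1` one has `y ≤ L ≤ y + 2 / √s`, and `y * exp (-(√(s *
y) / 2))` is at most the first term, whose sum over `k` is bounded uniformly in `y`; this avoids an
additional logarithm. For `s > 1`, `L * exp (-(√(s * L) / 2))` is at most `8`. -/
lemma boundary_term_le {y s L : ℝ} (hy : 0 < y) (hs : 0 < s) (hL : L = y - Real.log s)
    (hL0 : 1 ≤ L) :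
    L * (Real.exp (-(√(s * L) / 2)) * Real.exp (-(s / 8)))
      ≤ 24 * y * (1 / (1 + y / 4 * s) ^ 2) + (if s ≤ 1 then 2 / √s else 0)
        + 8 * Real.exp (-(s / 8)) := by
  have hE : Real.exp (-(s / 8)) ≤ 1 := Real.exp_le_one_iff.2 (by linarith)
  have hE0 := Real.exp_pos (-(s / 8))
  have hq : 0 ≤ 24 * y * (1 / (1 + y / 4 * s) ^ 2) := by positivity
  split_ifs with h1
  · have hss : 0 < √s := Real.sqrt_pos.2 hs
    have hlog : -Real.log s ≤ 2 / √s := by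
      have := Real.log_le_sub_one_of_pos (by positivity : 0 < 1 / √s)
      rw [one_div, Real.log_inv, Real.log_sqrt hs.le] at this
      have e : 2 / √s = 2 * (√s)⁻¹ := by ring
      linarith
    have hLy : y ≤ L := by
      have := Real.log_nonpos hs.le h1
      linarith
    have h2 : Real.exp (-(√(s * L) / 2)) ≤ Real.exp (-(√(s * y) / 2)) := by
      apply Real.exp_le_exp.2
      have := Real.sqrt_le_sqrt (mul_le_mul_of_nonneg_left hLy hs.le)
      linarith
    have h3 := exp_neg_le_inv_sq (by positivity : 0 ≤ √(s * y) / 2)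
    have e3 : (√(s * y) / 2) ^ 2 = y / 4 * s := by
      rw [div_pow, Real.sq_sqrt (by positivity)]; ring
    rw [e3] at h3
    have h4 : Real.exp (-(√(s * y) / 2)) ≤ 1 := Real.exp_le_one_iff.2 (by
      have := Real.sqrt_nonneg (s * y); linarith)
    have h5 : Real.exp (-(√(s * L) / 2)) * Real.exp (-(s / 8)) ≤ Real.exp (-(√(s * y) / 2)) := by
      calc _ ≤ Real.exp (-(√(s * y) / 2)) * 1 := mul_le_mul h2 hE hE0.le (Real.exp_pos _).le
        _ = _ := mul_one _
    have h6 : L ≤ y + 2 / √s := by linarith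
    calc L * (Real.exp (-(√(s * L) / 2)) * Real.exp (-(s / 8)))
        ≤ (y + 2 / √s) * Real.exp (-(√(s * y) / 2)) :=
          mul_le_mul h6 h5 (by positivity) (by positivity)
      _ = y * Real.exp (-(√(s * y) / 2)) + 2 / √s * Real.exp (-(√(s * y) / 2)) := by ring
      _ ≤ y * (24 / (1 + y / 4 * s) ^ 2) + 2 / √s * 1 := by gcongr
      _ = 24 * y * (1 / (1 + y / 4 * s) ^ 2) + 2 / √s := by ring
      _ ≤ _ := by linarith
  · have h2 : L * Real.exp (-(√(s * L) / 2)) ≤ 8 := by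
      have h3 : √L ≤ √(s * L) := Real.sqrt_le_sqrt (by nlinarith)
      have h4 : L ≤ 8 * Real.exp (√(s * L) / 2) := by
        have h5 := Real.quadratic_le_exp_of_nonneg (x := √(s * L) / 2) (by positivity)
        have h6 : √L ^ 2 = L := Real.sq_sqrt (by linarith)
        have h7 : 0 ≤ √L := Real.sqrt_nonneg L
        nlinarith
      rw [Real.exp_neg, ← div_eq_mul_inv, div_le_iff₀ (Real.exp_pos _)]
      exact h4
    nlinarith

/-- The crossing probabilities of the boundary sum up to a multiple of `ε ^ (-2)`. -/
lemma sum_boundary_term_le {ε y : ℝ} (hε : 0 < ε) (hy : 0 < y) (n : ℕ) :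
    ∑ k ∈ Finset.Icc 1 n with 1 ≤ y - Real.log (ε ^ 2 * (k : ℕ)),
      (y - Real.log (ε ^ 2 * k)) * (Real.exp (-(√(ε ^ 2 * k * (y - Real.log (ε ^ 2 * k))) / 2))
        * Real.exp (-(ε ^ 2 * k / 8))) ≤ 164 / ε ^ 2 := by
  have hε2 : 0 < ε ^ 2 := by positivity
  have hA : ∑ k ∈ Finset.Icc 1 n, 24 * y * (1 / (1 + y / 4 * (ε ^ 2 * (k : ℕ))) ^ 2)
      ≤ 96 / ε ^ 2 := by
    rw [← Finset.mul_sum]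
    have := sum_inv_sq_le (c := y / 4 * ε ^ 2) (by positivity) n
    calc 24 * y * ∑ k ∈ Finset.Icc 1 n, 1 / (1 + y / 4 * (ε ^ 2 * (k : ℝ))) ^ 2
        = 24 * y * ∑ k ∈ Finset.Icc 1 n, 1 / (1 + y / 4 * ε ^ 2 * (k : ℝ)) ^ 2 := by
          simp_rw [mul_assoc]
      _ ≤ 24 * y * (1 / (y / 4 * ε ^ 2)) := by gcongr
      _ = 96 / ε ^ 2 := by field_simp; norm_num
  have hB : ∑ k ∈ Finset.Icc 1 n, (if ε ^ 2 * (k : ℕ) ≤ 1 then 2 / √(ε ^ 2 * (k : ℕ)) else 0)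
      ≤ 4 / ε ^ 2 := by
    rw [← Finset.sum_filter]
    have hsub : (Finset.Icc 1 n).filter (fun k : ℕ => ε ^ 2 * k ≤ 1)
        ⊆ Finset.Icc 1 ⌊1 / ε ^ 2⌋₊ := by
      intro k hk
      obtain ⟨hk1, hk2⟩ := Finset.mem_filter.1 hk
      refine Finset.mem_Icc.2 ⟨(Finset.mem_Icc.1 hk1).1, Nat.le_floor ?_⟩
      rw [le_div_iff₀ hε2]; linarith
    refine (Finset.sum_le_sum_of_subset_of_nonneg hsub fun k _ _ => by positivity).trans ?_
    have e : ∀ k : ℕ, 2 / √(ε ^ 2 * k) = 2 / ε * (1 / √k) := fun k => by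
      rw [Real.sqrt_mul hε2.le, Real.sqrt_sq hε.le]; ring
    simp_rw [e]
    rw [← Finset.mul_sum]
    have h1 := sum_inv_sqrt_le ⌊1 / ε ^ 2⌋₊
    have h2 : √(⌊1 / ε ^ 2⌋₊ : ℝ) ≤ 1 / ε := by
      rw [Real.sqrt_le_left (by positivity)]
      refine (Nat.floor_le (by positivity)).trans (le_of_eq ?_)
      field_simp
    calc 2 / ε * ∑ k ∈ Finset.Icc 1 ⌊1 / ε ^ 2⌋₊, 1 / √(k : ℝ) ≤ 2 / ε * (2 * (1 / ε)) := by
          gcongr; linarith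
      _ = 4 / ε ^ 2 := by field_simp; norm_num
  have hC : ∑ k ∈ Finset.Icc 1 n, 8 * Real.exp (-(ε ^ 2 * (k : ℕ) / 8)) ≤ 64 / ε ^ 2 := by
    rw [← Finset.mul_sum]
    have := sum_exp_neg_mul_le (c := ε ^ 2 / 8) (by positivity) (Finset.Icc 1 n)
      fun k hk => (Finset.mem_Icc.1 hk).1
    calc 8 * ∑ k ∈ Finset.Icc 1 n, Real.exp (-(ε ^ 2 * (k : ℝ) / 8))
        = 8 * ∑ k ∈ Finset.Icc 1 n, Real.exp (-(ε ^ 2 / 8 * (k : ℝ))) := by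
          congr 1; refine Finset.sum_congr rfl fun k _ => ?_; ring_nf
      _ ≤ 8 * (1 / (ε ^ 2 / 8)) := by gcongr
      _ = 64 / ε ^ 2 := by field_simp; norm_num
  have hterm : ∀ k ∈ (Finset.Icc 1 n).filter (fun k : ℕ => 1 ≤ y - Real.log (ε ^ 2 * k)),
      (y - Real.log (ε ^ 2 * k)) * (Real.exp (-(√(ε ^ 2 * k * (y - Real.log (ε ^ 2 * k))) / 2))
        * Real.exp (-(ε ^ 2 * k / 8)))
      ≤ 24 * y * (1 / (1 + y / 4 * (ε ^ 2 * (k : ℕ))) ^ 2)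
        + (if ε ^ 2 * (k : ℕ) ≤ 1 then 2 / √(ε ^ 2 * (k : ℕ)) else 0)
        + 8 * Real.exp (-(ε ^ 2 * (k : ℕ) / 8)) := by
    intro k hk
    obtain ⟨hk1, hk2⟩ := Finset.mem_filter.1 hk
    have : (0 : ℝ) < k := by exact_mod_cast (Finset.mem_Icc.1 hk1).1
    exact boundary_term_le hy (by positivity) rfl hk2
  refine (Finset.sum_le_sum hterm).trans ?_
  refine (Finset.sum_le_sum_of_subset_of_nonneg (Finset.filter_subset _ _) fun k _ _ => ?_).trans ?_
  · have : (0 : ℝ) ≤ if ε ^ 2 * (k : ℝ) ≤ 1 then 2 / √(ε ^ 2 * (k : ℝ)) else 0 := by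
      split_ifs <;> positivity
    positivity
  rw [Finset.sum_add_distrib, Finset.sum_add_distrib]
  calc _ ≤ 96 / ε ^ 2 + 4 / ε ^ 2 + 64 / ε ^ 2 := add_le_add (add_le_add hA hB) hC
    _ = 164 / ε ^ 2 := by ring

/-! ### Superharmonic functions of the Gaussian random walk -/

/-- A nonnegative function of time and position is superharmonic if it does not increase in mean
along the Gaussian random walk. -/
structure IsSuperharmonic (V : ℕ → ℝ → ENNReal) : Prop where
  measurable : ∀ T, Measurable (V T)
  mean_le : ∀ T w, ∫⁻ z, V (T + 1) (w + z) ∂gaussianReal 0 1 ≤ V T w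

lemma isSuperharmonic_const (c : ENNReal) : IsSuperharmonic fun _ _ => c :=
  ⟨fun _ => measurable_const, fun _ _ => by simp⟩

lemma IsSuperharmonic.measurable_shift {V : ℕ → ℝ → ENNReal} (h : IsSuperharmonic V) (T : ℕ)
    (w : ℝ) : Measurable fun z => V T (w + z) :=
  (h.measurable T).comp (measurable_const_add w)

lemma IsSuperharmonic.add {V V' : ℕ → ℝ → ENNReal} (h : IsSuperharmonic V)
    (h' : IsSuperharmonic V') : IsSuperharmonic fun T w => V T w + V' T w where
  measurable T := (h.measurable T).add (h'.measurable T)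
  mean_le T w := by
    rw [lintegral_add_left (h.measurable_shift (T + 1) w)]
    exact add_le_add (h.mean_le T w) (h'.mean_le T w)

lemma IsSuperharmonic.const_mul {V : ℕ → ℝ → ENNReal} (h : IsSuperharmonic V) (c : ENNReal) :
    IsSuperharmonic fun T w => c * V T w where
  measurable T := (h.measurable T).const_mul c
  mean_le T w := by
    rw [lintegral_const_mul c (h.measurable_shift (T + 1) w)]
    exact mul_le_mul_right (h.mean_le T w) c

lemma IsSuperharmonic.sum {ι : Type*} (s : Finset ι) {V : ι → ℕ → ℝ → ENNReal}
    (h : ∀ i ∈ s, IsSuperharmonic (V i)) : IsSuperharmonic fun T w => ∑ i ∈ s, V i T w where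
  measurable T := Finset.measurable_fun_sum _ fun i hi => (h i hi).measurable T
  mean_le T w := by
    rw [lintegral_finsetSum _ fun i hi => (h i hi).measurable_shift (T + 1) w]
    exact Finset.sum_le_sum fun i hi => (h i hi).mean_le T w

lemma lintegral_exp_walk (l κ w : ℝ) (T : ℕ) :
    ∫⁻ z, ENNReal.ofReal (Real.exp (l * (w + z) - κ * ((T + 1 : ℕ) : ℝ))) ∂gaussianReal 0 1
      = ENNReal.ofReal (Real.exp (l ^ 2 / 2 - κ)) * ENNReal.ofReal (Real.exp (l * w - κ * T)) := by
  have e : ∀ z, ENNReal.ofReal (Real.exp (l * (w + z) - κ * ((T + 1 : ℕ) : ℝ)))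
      = ENNReal.ofReal (Real.exp (l * w - κ * (T + 1))) * ENNReal.ofReal (Real.exp (l * z)) := by
    intro z
    rw [← ENNReal.ofReal_mul (Real.exp_pos _).le, ← Real.exp_add]
    congr 2; push_cast; ring
  simp_rw [e]
  rw [lintegral_const_mul _ (by fun_prop), lintegral_exp_mul_gaussianReal,
    ← ENNReal.ofReal_mul (Real.exp_pos _).le, ← ENNReal.ofReal_mul (Real.exp_pos _).le,
    ← Real.exp_add, ← Real.exp_add]
  congr 2; simp; ring

lemma isSuperharmonic_exp (l : ℝ) :
    IsSuperharmonic fun T w => ENNReal.ofReal (Real.exp (l * w - l ^ 2 / 2 * T)) where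
  measurable T := by fun_prop
  mean_le T w := by
    rw [lintegral_exp_walk]; simp

lemma lintegral_gaussianReal_Ici_sub (v : ℝ≥0) (r : ℝ) :
    ∫⁻ z, gaussianReal 0 v (Set.Ici (r - z)) ∂gaussianReal 0 1
      = gaussianReal 0 (v + 1) (Set.Ici r) := by
  have h := gaussianReal_conv_gaussianReal (m₁ := 0) (m₂ := 0) (v₁ := 1) (v₂ := v)
  rw [add_zero, add_comm 1 v] at h
  rw [← h, Measure.conv, Measure.map_apply (by fun_prop) measurableSet_Ici,
    Measure.prod_apply (measurableSet_Ici.preimage (by fun_prop))]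
  refine lintegral_congr fun z => ?_
  congr 1
  ext y
  simp only [Set.mem_Ici, Set.mem_preimage]
  constructor <;> intro h <;> linarith

/-- The probability that the walk, now at time `T` and position `w`, is at least `b` at time `k`. -/
def tailPotential (k : ℕ) (b : ℝ) (T : ℕ) (w : ℝ) : ENNReal :=
  if T ≤ k then gaussianReal 0 ((k - T : ℕ) : ℝ≥0) (Set.Ici (b - w)) else 0

/-- Up to time `k` it is a martingale, by the convolution of Gaussian measures; afterwards it drops
to `0`. -/
lemma isSuperharmonic_tailPotential (k : ℕ) (b : ℝ) : IsSuperharmonic (tailPotential k b) where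
  measurable T := by
    unfold tailPotential
    split_ifs
    · exact Monotone.measurable fun w w' h => measure_mono (Set.Ici_subset_Ici.2 (by linarith))
    · exact measurable_const
  mean_le T w := by
    unfold tailPotential
    by_cases h : T + 1 ≤ k
    · have h' : T ≤ k := by omega
      simp only [h, h', if_true]
      have e : ((k - T : ℕ) : ℝ≥0) = ((k - (T + 1) : ℕ) : ℝ≥0) + 1 := by
        have : k - T = k - (T + 1) + 1 := by omega
        rw [this]; push_cast; rfl
      rw [e, ← lintegral_gaussianReal_Ici_sub]
      refine le_of_eq (lintegral_congr fun z => ?_)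
      congr 2; ring
    · simp [h]

lemma half_le_tailPotential {k T : ℕ} (hT : T ≤ k) {b w : ℝ} (hb : b ≤ w) :
    1 / 2 ≤ tailPotential k b T w := by
  unfold tailPotential
  rw [if_pos hT]
  exact half_le_gaussianReal_Ici _ (by linarith)

lemma tailPotential_zero_le {k : ℕ} (hk : 1 ≤ k) {b : ℝ} (hb : 0 < b) :
    tailPotential k b 0 0 ≤ ENNReal.ofReal (√k / b * Real.exp (-b ^ 2 / (2 * k))) := by
  have h := gaussianReal_real_Ici_le_div (v := (k : ℝ≥0)) (by positivity) hb
  unfold tailPotential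
  simp only [zero_le, if_true, Nat.sub_zero, sub_zero]
  rw [← ofReal_measureReal]
  exact ENNReal.ofReal_le_ofReal (by simpa using h)

/-! ### The index of an arm is rarely much smaller than its mean -/

/-- The weight `16 * L / (k + L)` is matched to `exp (-halfSq L k)`, which is `√L * (k + L) / (exp L
* k)`: together with the factor `1 / √L` from Mills' bound it leaves `L * A / m`. The slope `ε / 2`
of the boundary supplies the remaining exponentials. -/
lemma crossing_term_le {A L k m ε : ℝ} (hA : 0 < A) (hL : 20 ≤ L) (hk : 1 ≤ k)
    (hm : m = A * k * Real.exp L) (hε : 0 < ε) :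
    16 * L / (k + L) * (√k / (ε * k / 2 + √(2 * (halfSq L k - 3)) * √k) *
        Real.exp (-(ε * k / 2 + √(2 * (halfSq L k - 3)) * √k) ^ 2 / (2 * k)))
      ≤ 16 * Real.exp 3 * A / m * (L * (Real.exp (-(√(ε ^ 2 * k * L) / 2))
        * Real.exp (-(ε ^ 2 * k / 8)))) := by
  have hk0 : 0 < k := by linarith
  have hL0 : 0 < L := by linarith
  have hge := halfSq_ge hL hk
  set η := √(2 * (halfSq L k - 3)) with hη
  have hη2 : η ^ 2 = 2 * (halfSq L k - 3) := Real.sq_sqrt (by linarith)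
  have hLη : √L ≤ η := Real.sqrt_le_sqrt (by linarith)
  have hLs : 0 < √L := Real.sqrt_pos.2 hL0
  have hks : 0 < √k := Real.sqrt_pos.2 hk0
  have hk2 : √k ^ 2 = k := Real.sq_sqrt hk0.le
  have hL2 : √L ^ 2 = L := Real.sq_sqrt hL0.le
  have h1 : √k / (ε * k / 2 + η * √k) ≤ 1 / √L := by
    rw [div_le_div_iff₀ (by positivity) hLs]
    have : 0 < ε * k / 2 := by positivity
    nlinarith
  have hsq : √(ε ^ 2 * k * L) = ε * √k * √L := by
    rw [Real.sqrt_mul (by positivity), Real.sqrt_mul (by positivity), Real.sqrt_sq hε.le]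
  have h2 : Real.exp (-(ε * k / 2 + η * √k) ^ 2 / (2 * k))
      ≤ Real.exp (3 - halfSq L k) * (Real.exp (-(√(ε ^ 2 * k * L) / 2))
        * Real.exp (-(ε ^ 2 * k / 8))) := by
    rw [← Real.exp_add, ← Real.exp_add]
    apply Real.exp_le_exp.2
    have e : -(ε * k / 2 + η * √k) ^ 2 / (2 * k) = -(ε ^ 2 * k / 8) - ε * √k * η / 2 - η ^ 2 / 2 := by
      have h : ∀ q : ℝ, 0 < q → -(ε * q ^ 2 / 2 + η * q) ^ 2 / (2 * q ^ 2)
          = -(ε ^ 2 * q ^ 2 / 8) - ε * q * η / 2 - η ^ 2 / 2 := by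
        intro q hq; field_simp; ring
      have h' := h (√k) hks
      rwa [hk2] at h'
    rw [e, hη2, hsq]
    have : ε * √k * √L ≤ ε * √k * η := by gcongr
    linarith
  have h3 : Real.exp (3 - halfSq L k) = Real.exp 3 * (√L * (k + L)) / (Real.exp L * k) := by
    rw [Real.exp_sub, exp_halfSq hL0 hk0]
    have := Real.exp_pos L
    field_simp
  calc _ ≤ 16 * L / (k + L) * (1 / √L * (Real.exp (3 - halfSq L k) *
        (Real.exp (-(√(ε ^ 2 * k * L) / 2)) * Real.exp (-(ε ^ 2 * k / 8))))) := by
        gcongr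
    _ = _ := by
        have := Real.exp_pos L
        rw [h3, hm]
        field_simp

/-- For every horizon `m` and every `ε` there is a superharmonic function of small initial value that
is at least `1` wherever the index of the arm is less than its mean minus `ε`. -/
theorem exists_superharmonic_index :
    ∃ C : ℝ, 0 < C ∧ ∀ (m : ℕ) (ε : ℝ), 1 ≤ m → 0 < ε →
      ∃ V : ℕ → ℝ → ENNReal, IsSuperharmonic V ∧ V 0 0 ≤ ENNReal.ofReal (C / (m * ε ^ 2)) ∧
        ∀ (μ : ℝ) (T : ℕ) (w : ℝ), 1 ≤ T →
          gittinsIndex (μ - w / T) (T : ℝ≥0)⁻¹ m < μ - ε → 1 ≤ V T w := by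
  obtain ⟨C, hC1, hC⟩ := exists_add_div_sqrt_le_gittinsIndex
  set A := 3 * C with hA
  have hA0 : 0 < A := by linarith
  have hE21 := Real.exp_pos 21
  refine ⟨2 * (A * Real.exp 21) + 16 * Real.exp 3 * A * 164 + A, by positivity,
    fun m ε hm hε => ?_⟩
  have hm' : (1 : ℝ) ≤ m := by exact_mod_cast hm
  have hm0 : (0 : ℝ) < m := by linarith
  have hmε : 0 < m * ε ^ 2 := by positivity
  -- If `m * ε ^ 2 ≤ A`, the claimed bound on the initial value exceeds `1` and the constant `1`
  -- will do. Otherwise `y` below is positive.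
  rcases le_or_gt (m * ε ^ 2) A with hsmall | hbig
  · refine ⟨fun _ _ => 1, isSuperharmonic_const 1, ?_, fun _ _ _ _ _ => le_rfl⟩
    rw [← ENNReal.ofReal_one]
    apply ENNReal.ofReal_le_ofReal
    rw [le_div_iff₀ hmε, one_mul]
    have : 0 < 2 * (A * Real.exp 21) + 16 * Real.exp 3 * A * 164 := by positivity
    linarith
  set L : ℕ → ℝ := fun k => Real.log (m / (A * k)) with hL
  set y := Real.log (m * ε ^ 2 / A) with hy
  have hy0 : 0 < y := Real.log_pos ((one_lt_div hA0).2 hbig)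
  have hLy : ∀ k : ℕ, 1 ≤ k → L k = y - Real.log (ε ^ 2 * k) := by
    intro k hk
    have hk0 : (0 : ℝ) < k := by exact_mod_cast hk
    rw [hy, ← Real.log_div (by positivity) (by positivity)]
    simp only [hL]
    congr 1; field_simp
  have hexpL : ∀ k : ℕ, 1 ≤ k → (m : ℝ) = A * k * Real.exp (L k) := by
    intro k hk
    have hk0 : (0 : ℝ) < k := by exact_mod_cast hk
    simp only [hL]
    rw [Real.exp_log (by positivity)]; field_simp
  set b : ℕ → ℝ := fun k => ε * k / 2 + √(2 * (halfSq (L k) k - 3)) * √k with hb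
  -- A block that starts at `T ≤ m` ends by `2 * T`, hence the range up to `2 * m`.
  set S := (Finset.Icc 1 (2 * m)).filter (fun k => 20 ≤ L k) with hS
  have hS1 : ∀ k ∈ S, 1 ≤ k ∧ 20 ≤ L k := fun k hk =>
    ⟨(Finset.mem_Icc.1 (Finset.mem_filter.1 hk).1).1, (Finset.mem_filter.1 hk).2⟩
  -- The exponential martingale handles large counts, where `L T < 21` and `T` is comparable to `m`
  -- or larger; the tail potentials handle the others.
  set V : ℕ → ℝ → ENNReal := fun T w =>
    ENNReal.ofReal (2 * (A * Real.exp 21) / (m * ε ^ 2)) *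
      ENNReal.ofReal (Real.exp (ε * w - ε ^ 2 / 2 * T))
    + ∑ k ∈ S, ENNReal.ofReal (16 * L k / (k + L k)) * tailPotential k (b k) T w with hV
  refine ⟨V, ?_, ?_, ?_⟩
  · exact ((isSuperharmonic_exp ε).const_mul _).add
      (IsSuperharmonic.sum S fun k _ => (isSuperharmonic_tailPotential k (b k)).const_mul _)
  · have hsum : ∑ k ∈ S, ENNReal.ofReal (16 * L k / (k + L k)) * tailPotential k (b k) 0 0
        ≤ ENNReal.ofReal (16 * Real.exp 3 * A * 164 / (m * ε ^ 2)) := by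
      have hterm : ∀ k ∈ S, ENNReal.ofReal (16 * L k / (k + L k)) * tailPotential k (b k) 0 0
          ≤ ENNReal.ofReal (16 * Real.exp 3 * A / m * (L k * (Real.exp (-(√(ε ^ 2 * k * L k) / 2))
        * Real.exp (-(ε ^ 2 * k / 8))))) := by
        intro k hk
        obtain ⟨hk1, hk20⟩ := hS1 k hk
        have hk1' : (1 : ℝ) ≤ k := by exact_mod_cast hk1
        have hbk : 0 < b k := by
          have h1 : 0 < ε * k / 2 := by positivity
          have h2 : 0 ≤ √(2 * (halfSq (L k) k - 3)) * √(k : ℝ) := by positivity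
          simp only [hb]; linarith
        refine (mul_le_mul_right (tailPotential_zero_le hk1 hbk) _).trans ?_
        rw [← ENNReal.ofReal_mul (by positivity)]
        exact ENNReal.ofReal_le_ofReal (crossing_term_le hA0 hk20 hk1' (hexpL k hk1) hε)
      refine (Finset.sum_le_sum hterm).trans ?_
      rw [← ENNReal.ofReal_sum_of_nonneg (fun k hk => by
        have := (hS1 k hk).2
        positivity), ← Finset.mul_sum]
      apply ENNReal.ofReal_le_ofReal
      have h1 : ∑ k ∈ S, L k * (Real.exp (-(√(ε ^ 2 * k * L k) / 2)) * Real.exp (-(ε ^ 2 * k / 8)))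
          ≤ 164 / ε ^ 2 := by
        refine le_trans ?_ (sum_boundary_term_le hε hy0 (2 * m))
        have hsub : S ⊆ (Finset.Icc 1 (2 * m)).filter
            (fun k : ℕ => 1 ≤ y - Real.log (ε ^ 2 * k)) := by
          intro k hk
          refine Finset.mem_filter.2 ⟨(Finset.mem_filter.1 hk).1, ?_⟩
          rw [← hLy k (hS1 k hk).1]
          linarith [(hS1 k hk).2]
        refine le_trans (le_of_eq (Finset.sum_congr rfl fun k hk => ?_))
          (Finset.sum_le_sum_of_subset_of_nonneg hsub fun k hk _ => ?_)
        · rw [hLy k (hS1 k hk).1]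
        · have := (Finset.mem_filter.1 hk).2
          positivity
      calc _ ≤ 16 * Real.exp 3 * A / m * (164 / ε ^ 2) := by gcongr
        _ = _ := by field_simp
    have h0 : ENNReal.ofReal (Real.exp (ε * 0 - ε ^ 2 / 2 * (0 : ℕ))) = 1 := by simp
    simp only [hV]
    rw [h0, mul_one]
    refine (add_le_add le_rfl hsum).trans ?_
    rw [← ENNReal.ofReal_add (by positivity) (by positivity), ← add_div]
    apply ENNReal.ofReal_le_ofReal
    exact div_le_div_of_nonneg_right (by linarith) hmε.le
  · intro μ T w hT hidx
    have hT' : (1 : ℝ) ≤ T := by exact_mod_cast hT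
    have hT0 : (0 : ℝ) < T := by linarith
    have hTne : ((T : ℝ≥0)⁻¹ : ℝ≥0) ≠ 0 := by
      have : (T : ℝ≥0) ≠ 0 := by positivity
      exact inv_ne_zero this
    -- For large counts it is enough that the index is at least the empirical mean: then `w > ε *
    -- T`, so the martingale is at least `ε ^ 2 * T / 2`. The threshold `21` leaves room for `L` to
    -- drop by `1` within a block and stay above `20`.
    rcases lt_or_ge (L T) 21 with hlt | hge
    · have hw : ε * T < w := by
        have := (le_gittinsIndex (μ - w / T) hTne hm).trans_lt hidx
        have h2 : ε < w / T := by linarith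
        rwa [lt_div_iff₀ hT0] at h2
      have hTm : (m : ℝ) ≤ A * T * Real.exp 21 := by
        rw [hexpL T hT]
        gcongr
      refine le_trans ?_ le_self_add
      rw [← ENNReal.ofReal_mul (by positivity), ← ENNReal.ofReal_one]
      apply ENNReal.ofReal_le_ofReal
      have h1 : ε ^ 2 * T / 2 ≤ Real.exp (ε * w - ε ^ 2 / 2 * T) := by
        have := Real.add_one_le_exp (ε * w - ε ^ 2 / 2 * T)
        nlinarith
      calc (1 : ℝ) ≤ 2 * (A * Real.exp 21) / (m * ε ^ 2) * (ε ^ 2 * T / 2) := by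
            have e : 2 * (A * Real.exp 21) / (m * ε ^ 2) * (ε ^ 2 * T / 2)
              = A * T * Real.exp 21 / m := by field_simp
            rw [e, le_div_iff₀ hm0, one_mul]; exact hTm
        _ ≤ _ := by gcongr
    · have h20 : 20 ≤ L T := by linarith
      set x := √(2 * halfSq (L T) T) with hx
      have hsq := halfSq_ge h20 hT'
      have hx1 : 1 ≤ x := Real.one_le_sqrt.2 (by linarith)
      have hindex := hC (μ - w / T) T m x hT hx1 (by
        have h1 := exp_halfSq_mul_le h20 hT'
        rw [← hx] at h1
        calc C * (Real.exp (x ^ 2 / 2) * (x * (T + x ^ 2))) ≤ C * (3 * (Real.exp (L T) * T)) := by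
              gcongr
          _ = m := by rw [hexpL T hT, hA]; ring)
      have hw : ε * T + x * √T ≤ w := by
        have h1 : ε + x / √T < w / T := by linarith
        rw [lt_div_iff₀ hT0] at h1
        have hs : 0 < √(T : ℝ) := Real.sqrt_pos.2 hT0
        have e : (ε + x / √T) * T = ε * T + x * √T := by
          have : (T : ℝ) = √T * √T := (Real.mul_self_sqrt hT0.le).symm
          rw [add_mul]
          congr 1
          rw [div_mul_eq_mul_div, div_eq_iff hs.ne', mul_assoc, ← this]
        linarith
      set B := Finset.Icc T (T + ⌊T / L T⌋₊) with hB
      have hBk : ∀ k ∈ B, (T : ℝ) ≤ k ∧ (k : ℝ) ≤ T + T / L T := by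
        intro k hk
        obtain ⟨h1, h2⟩ := Finset.mem_Icc.1 hk
        refine ⟨by exact_mod_cast h1, ?_⟩
        have h4 : (k : ℝ) ≤ T + (⌊T / L T⌋₊ : ℕ) := by exact_mod_cast h2
        have := Nat.floor_le (by positivity : 0 ≤ T / L T)
        linarith
      have hLk : ∀ k ∈ B, 20 ≤ L k ∧ L k ≤ L T ∧ L T ≤ L k + 1 := by
        intro k hk
        obtain ⟨h1, h2⟩ := hBk k hk
        have hk0 : (0 : ℝ) < k := by linarith
        have hTL : T / L T ≤ T := div_le_self (by linarith) (by linarith)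
        have e : L T = L k + Real.log (k / T) := by
          simp only [hL]
          rw [← Real.log_mul (by positivity) (by positivity)]
          congr 1; field_simp
        have h3 : 0 ≤ Real.log (k / T) := Real.log_nonneg ((one_le_div hT0).2 h1)
        have h4 : Real.log (k / T) ≤ 1 := by
          have : Real.log (k / T) ≤ Real.log 2 :=
            Real.log_le_log (by positivity) ((div_le_iff₀ hT0).2 (by linarith))
          have := Real.log_two_lt_d9
          linarith
        refine ⟨by linarith, by linarith, by linarith⟩
      have hTm : T ≤ m := by
        have h1 : (T : ℝ) ≤ m := by
          rw [hexpL T hT]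
          have h2 : 1 ≤ Real.exp (L T) := Real.one_le_exp (by linarith)
          have h3 : 1 ≤ A := by linarith
          calc (T : ℝ) = 1 * T * 1 := by ring
            _ ≤ A * T * Real.exp (L T) := by gcongr
        exact_mod_cast h1
      have hBS : B ⊆ S := by
        intro k hk
        obtain ⟨h1, h2⟩ := hBk k hk
        have hTL : T / L T ≤ T := div_le_self (by linarith) (by linarith)
        have hk2 : k ≤ 2 * T := by
          have : (k : ℝ) ≤ 2 * T := by linarith
          exact_mod_cast this
        refine Finset.mem_filter.2 ⟨Finset.mem_Icc.2 ⟨?_, by omega⟩, (hLk k hk).1⟩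
        exact hT.trans (Finset.mem_Icc.1 hk).1
      have hone := one_le_block_sum hT hge hLk
      refine le_trans ?_ le_add_self
      refine le_trans ?_ (Finset.sum_le_sum_of_subset hBS)
      rw [← ENNReal.ofReal_one]
      refine (ENNReal.ofReal_le_ofReal hone).trans ?_
      rw [ENNReal.ofReal_sum_of_nonneg fun k hk => by
        have := (hLk k hk).1
        positivity]
      refine Finset.sum_le_sum fun k hk => ?_
      obtain ⟨h1, h2⟩ := hBk k hk
      obtain ⟨h3, h4, h5⟩ := hLk k hk
      have hbw : b k ≤ w := (boundary_block_le h3 hT' h4 h5 h1 h2 hε.le).trans hw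
      have hhalf := half_le_tailPotential (by exact_mod_cast h1 : T ≤ k) hbw
      rw [div_eq_mul_one_div _ (2 : ℝ), ENNReal.ofReal_mul (by positivity)]
      refine mul_le_mul_right (le_trans (le_of_eq ?_) hhalf) _
      rw [ENNReal.ofReal_div_of_pos (by norm_num)]; simp

/-! ### Potentials along the plays of an arm -/

variable {Ω : Type*} {d : ℕ}

/-- The sum of the deviations, with sign `e`, of the rewards of arm `i` from its mean. -/
def armWalk (e : ℝ) (μ : Fin d → ℝ) (I : ℕ → Ω → Fin d) (X : ℕ → Ω → ℝ) (i : Fin d) (t : ℕ)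
    (ω : Ω) : ℝ :=
  ∑ s ∈ Finset.range t, if I s ω = i then e * (X s ω - μ i) else 0

lemma armCount_eq_sum (I : ℕ → Ω → Fin d) (i : Fin d) (t : ℕ) (ω : Ω) :
    armCount I i t ω = ∑ s ∈ Finset.range t, if I s ω = i then 1 else 0 := by
  rw [armCount, Finset.card_filter]

lemma armCount_succ (I : ℕ → Ω → Fin d) (i : Fin d) (t : ℕ) (ω : Ω) :
    armCount I i (t + 1) ω = armCount I i t ω + if I t ω = i then 1 else 0 := by
  rw [armCount_eq_sum, armCount_eq_sum, Finset.sum_range_succ]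

lemma armWalk_succ (e : ℝ) (μ : Fin d → ℝ) (I : ℕ → Ω → Fin d) (X : ℕ → Ω → ℝ) (i : Fin d) (t : ℕ)
    (ω : Ω) : armWalk e μ I X i (t + 1) ω
      = armWalk e μ I X i t ω + if I t ω = i then e * (X t ω - μ i) else 0 := by
  rw [armWalk, armWalk, Finset.sum_range_succ]

lemma armWalk_eq (e : ℝ) (μ : Fin d → ℝ) (I : ℕ → Ω → Fin d) (X : ℕ → Ω → ℝ) (i : Fin d) (t : ℕ)
    (ω : Ω) (h : 1 ≤ armCount I i t ω) :
    armWalk e μ I X i t ω = armCount I i t ω * (e * (empMean I X i t ω - μ i)) := by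
  have h0 : (armCount I i t ω : ℝ) ≠ 0 := by positivity
  have h1 : armWalk e μ I X i t ω = e * (∑ s ∈ (Finset.range t).filter (fun s => I s ω = i), X s ω
      - armCount I i t ω * μ i) := by
    rw [armWalk, ← Finset.sum_filter, ← Finset.mul_sum, Finset.sum_sub_distrib, Finset.sum_const,
      nsmul_eq_mul, armCount]
  rw [h1, empMean]
  field_simp

instance (μ : Fin d → ℝ) : IsMarkovKernel (rewardKernel μ) :=
  ⟨fun i => by
    change IsProbabilityMeasure (gaussianReal (μ i) 1)
    infer_instance⟩

/-- The sign `e` lets one argument serve both the upward deviations of the suboptimal arm (`e = 1`)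
and the downward ones of the optimal arm (`e = -1`). -/
lemma lintegral_gaussianReal_signed {e : ℝ} (he : e ^ 2 = 1) (c : ℝ) {f : ℝ → ENNReal}
    (hf : Measurable f) :
    ∫⁻ x, f (e * (x - c)) ∂gaussianReal c 1 = ∫⁻ z, f z ∂gaussianReal 0 1 := by
  have h : (gaussianReal c 1).map (fun x => e * (x - c)) = gaussianReal 0 1 := by
    have h1 := gaussianReal_map_sub_const (μ := c) (v := 1) c
    have h2 := gaussianReal_map_const_mul (μ := c - c) (v := 1) e
    rw [← h1, Measure.map_map (by fun_prop) (by fun_prop)] at h2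
    rw [show (fun x => e * (x - c)) = (e * ·) ∘ fun x => x - c from rfl, h2]
    congr 1
    · simp
    · ext; simp [he]
  rw [← h, lintegral_map hf (by fun_prop)]

section Potential

variable [MeasurableSpace Ω] {P : Measure Ω} {μ : Fin d → ℝ} {n : ℕ}
  {I : ℕ → Ω → Fin d} {X : ℕ → Ω → ℝ}

lemma IsInteraction.measurable_armCount (h : IsInteraction P μ n I X) (i : Fin d) (t : ℕ) :
    Measurable (armCount I i t) := by
  have : armCount I i t = fun ω => ∑ s ∈ Finset.range t, if I s ω = i then 1 else 0 := by
    funext ω; exact armCount_eq_sum I i t ω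
  rw [this]
  refine Finset.measurable_fun_sum _ fun s _ => ?_
  exact Measurable.ite (h.measurable_arm s (measurableSet_singleton i)) measurable_const
    measurable_const

lemma IsInteraction.measurable_armWalk (h : IsInteraction P μ n I X) (e : ℝ) (i : Fin d) (t : ℕ) :
    Measurable (armWalk e μ I X i t) := by
  unfold armWalk
  refine Finset.measurable_fun_sum _ fun s _ => ?_
  have := h.measurable_reward s
  exact Measurable.ite (h.measurable_arm s (measurableSet_singleton i)) (by fun_prop)
    measurable_const

lemma measurable_comp_nat_real {α : Type*} [MeasurableSpace α] {V : ℕ → ℝ → ENNReal}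
    (hV : ∀ T, Measurable (V T)) {f : α → ℕ} {g : α → ℝ} (hf : Measurable f) (hg : Measurable g) :
    Measurable fun a => V (f a) (g a) := by
  have : Measurable (Function.uncurry V) := measurable_from_prod_countable_right hV
  exact this.comp (hf.prodMk hg)

variable [IsProbabilityMeasure P]

/-- One round of the bandit: a potential decreases in mean by the cost of a play of arm `i`. -/
lemma IsInteraction.lintegral_potential_step (h : IsInteraction P μ n I X) (i : Fin d) {e : ℝ}
    (he : e ^ 2 = 1) {V c : ℕ → ℝ → ENNReal} (hV : ∀ T, Measurable (V T))
    (hc : ∀ T, Measurable (c T))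
    (hstep : ∀ T w, c T w + ∫⁻ z, V (T + 1) (w + z) ∂gaussianReal 0 1 ≤ V T w) {t : ℕ}
    (ht : t < n) :
    ∫⁻ ω, {ω | I t ω = i}.indicator (fun ω => c (armCount I i t ω) (armWalk e μ I X i t ω)) ω ∂P
      + ∫⁻ ω, V (armCount I i (t + 1) ω) (armWalk e μ I X i (t + 1) ω) ∂P
      ≤ ∫⁻ ω, V (armCount I i t ω) (armWalk e μ I X i t ω) ∂P := by
  set H : Ω → (Fin t → Fin d × ℝ) × Fin d := fun ω => (history I X t ω, I t ω) with hH
  have hHm : Measurable H := by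
    refine Measurable.prodMk (measurable_pi_lambda _ fun s => ?_) (h.measurable_arm t)
    exact (h.measurable_arm s).prodMk (h.measurable_reward s)
  -- Count and walk are written as functions of the history, so that the conditional law of the
  -- reward given history and arm can be applied.
  let cnt : (Fin t → Fin d × ℝ) → ℕ := fun g => ∑ s, if (g s).1 = i then 1 else 0
  let wlk : (Fin t → Fin d × ℝ) → ℝ := fun g => ∑ s, if (g s).1 = i then e * ((g s).2 - μ i) else 0
  have hset : ∀ s : Fin t, MeasurableSet {g : Fin t → Fin d × ℝ | (g s).1 = i} := fun s =>
    (measurable_fst.comp (measurable_pi_apply s)) (measurableSet_singleton i)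
  have hcnt : Measurable cnt := Finset.measurable_fun_sum _ fun s _ =>
    Measurable.ite (hset s) measurable_const measurable_const
  have hwlk : Measurable wlk := Finset.measurable_fun_sum _ fun s _ =>
    Measurable.ite (hset s) (by fun_prop) measurable_const
  have ecnt : ∀ ω, armCount I i t ω = cnt (history I X t ω) := fun ω => by
    rw [armCount_eq_sum, Finset.sum_range]; rfl
  have ewlk : ∀ ω, armWalk e μ I X i t ω = wlk (history I X t ω) := fun ω => by
    rw [armWalk, Finset.sum_range]; rfl
  let Φ : ((Fin t → Fin d × ℝ) × Fin d) × ℝ → ENNReal := fun p =>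
    V (cnt p.1.1 + if p.1.2 = i then 1 else 0)
      (wlk p.1.1 + if p.1.2 = i then e * (p.2 - μ i) else 0)
  have hset2 : MeasurableSet {p : ((Fin t → Fin d × ℝ) × Fin d) × ℝ | p.1.2 = i} :=
    (measurable_snd.comp measurable_fst) (measurableSet_singleton i)
  have hΦ : Measurable Φ := by
    refine measurable_comp_nat_real hV ?_ ?_
    · exact (hcnt.comp (measurable_fst.comp measurable_fst)).add
        (Measurable.ite hset2 measurable_const measurable_const)
    · exact (hwlk.comp (measurable_fst.comp measurable_fst)).add
        (Measurable.ite hset2 (by fun_prop) measurable_const)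
  have hlaw := h.reward_law t ht
  have hint : ∫⁻ ω, V (armCount I i (t + 1) ω) (armWalk e μ I X i (t + 1) ω) ∂P
      = ∫⁻ ω, ∫⁻ x, Φ (H ω, x) ∂gaussianReal (μ (I t ω)) 1 ∂P := by
    have e1 : ∀ ω, V (armCount I i (t + 1) ω) (armWalk e μ I X i (t + 1) ω) = Φ (H ω, X t ω) := by
      intro ω
      rw [armCount_succ, armWalk_succ, ecnt, ewlk]
    simp_rw [e1]
    rw [← lintegral_map (f := Φ) (g := fun ω => (H ω, X t ω)) hΦ
      (hHm.prodMk (h.measurable_reward t)), hlaw.map_eq, Measure.lintegral_compProd hΦ,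
      lintegral_map hΦ.lintegral_kernel_prod_right' hHm]
    rfl
  rw [hint, ← lintegral_add_left]
  · refine lintegral_mono fun ω => ?_
    by_cases hi : I t ω = i
    · rw [Set.indicator_of_mem (show ω ∈ {ω | I t ω = i} from hi), ecnt, ewlk]
      simp only [Φ, hH, hi, if_true]
      rw [lintegral_gaussianReal_signed he (μ i)
        (f := fun z => V (cnt (history I X t ω) + 1) (wlk (history I X t ω) + z))
        ((hV _).comp (measurable_const_add _))]
      exact hstep _ _
    · rw [Set.indicator_of_notMem (show ω ∉ {ω | I t ω = i} from hi), ecnt, ewlk]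
      simp [Φ, hH, hi]
  · exact (measurable_comp_nat_real hc (h.measurable_armCount i t)
      (h.measurable_armWalk e i t)).indicator (h.measurable_arm t (measurableSet_singleton i))

/-- The expected costs of the plays of arm `i` are at most the initial value of the potential. -/
lemma IsInteraction.sum_lintegral_cost_le (h : IsInteraction P μ n I X) (i : Fin d) {e : ℝ}
    (he : e ^ 2 = 1) {V c : ℕ → ℝ → ENNReal} (hV : ∀ T, Measurable (V T))
    (hc : ∀ T, Measurable (c T))
    (hstep : ∀ T w, c T w + ∫⁻ z, V (T + 1) (w + z) ∂gaussianReal 0 1 ≤ V T w) {t : ℕ}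
    (ht : t ≤ n) :
    ∑ s ∈ Finset.range t, ∫⁻ ω, {ω | I s ω = i}.indicator
        (fun ω => c (armCount I i s ω) (armWalk e μ I X i s ω)) ω ∂P
      + ∫⁻ ω, V (armCount I i t ω) (armWalk e μ I X i t ω) ∂P ≤ V 0 0 := by
  induction t with
  | zero => simp [armCount, armWalk]
  | succ t ih =>
    rw [Finset.sum_range_succ, add_assoc]
    exact (add_le_add le_rfl (h.lintegral_potential_step i he hV hc hstep (by omega))).trans
      (ih (by omega))

/-- This controls an arm at a random, adaptively determined count without a union bound over the
counts: the pair of count and walk moves only when the arm is played, and then like a step of the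
Gaussian walk. -/
lemma IsInteraction.lintegral_superharmonic_le (h : IsInteraction P μ n I X) (i : Fin d) {e : ℝ}
    (he : e ^ 2 = 1) {V : ℕ → ℝ → ENNReal} (hV : IsSuperharmonic V) {t : ℕ} (ht : t ≤ n) :
    ∫⁻ ω, V (armCount I i t ω) (armWalk e μ I X i t ω) ∂P ≤ V 0 0 := by
  refine le_trans le_add_self (h.sum_lintegral_cost_le i he hV.measurable (c := fun _ _ => 0)
    (fun _ => measurable_const) (fun T w => ?_) ht)
  rw [zero_add]
  exact hV.mean_le T w

end Potential

/-! ### The number of plays of a suboptimal arm -/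

section Plays

variable {μ : Fin d → ℝ} {n : ℕ}
  {I : ℕ → Ω → Fin d} {X : ℕ → Ω → ℝ}

lemma gap_nonneg (μ : Fin d → ℝ) (i : Fin d) : 0 ≤ gap μ i :=
  sub_nonneg.2 (le_ciSup (Set.finite_range μ).bddAbove i)

lemma one_le_armCount {t : ℕ} {ω : Ω} (ht : d ≤ t) (hI : ∀ s < d, (I s ω : ℕ) = s) (i : Fin d) :
    1 ≤ armCount I i t ω := by
  rw [armCount, Nat.one_le_iff_ne_zero, Finset.card_ne_zero]
  exact ⟨i, Finset.mem_filter.2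
    ⟨Finset.mem_range.2 (i.isLt.trans_le ht), Fin.ext (hI i i.isLt)⟩⟩

/-- The cost of a play of an arm: plays within the first `K` are paid, and so are plays at which the
empirical mean exceeds the mean by at least `δ`. -/
def playCost (K : ℕ) (δ : ℝ) (T : ℕ) (w : ℝ) : ENNReal :=
  (if T < K then 1 else 0) + if T * δ ≤ w then 1 else 0

/-- A potential that covers `playCost`. -/
def playPotential (K : ℕ) (δ : ℝ) (T : ℕ) (w : ℝ) : ENNReal :=
  ((K - T : ℕ) : ENNReal)
    + ENNReal.ofReal (1 / (1 - Real.exp (-(δ ^ 2 / 2)))) * ENNReal.ofReal (Real.exp (δ * w - δ ^ 2 * T))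

lemma measurable_playCost (K : ℕ) (δ : ℝ) (T : ℕ) : Measurable (playCost K δ T) := by
  unfold playCost
  exact measurable_const.add (Measurable.ite (measurableSet_le measurable_const measurable_id)
    measurable_const measurable_const)

lemma measurable_playPotential (K : ℕ) (δ : ℝ) (T : ℕ) : Measurable (playPotential K δ T) := by
  unfold playPotential; fun_prop

/-- A play lowers `K - T` by one as long as `T < K`. The exponential shrinks in mean by the factor
`exp (-(δ ^ 2 / 2))` and is at least `1` where `T * δ ≤ w`, so the prefactor makes its decrease pay
for the second unit of cost. -/
lemma playPotential_step {δ : ℝ} (hδ : 0 < δ) (K T : ℕ) (w : ℝ) :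
    playCost K δ T w + ∫⁻ z, playPotential K δ (T + 1) (w + z) ∂gaussianReal 0 1
      ≤ playPotential K δ T w := by
  unfold playPotential
  rw [lintegral_add_left measurable_const, lintegral_const, measure_univ, mul_one,
    lintegral_const_mul _ (by fun_prop), lintegral_exp_walk]
  have hq : Real.exp (-(δ ^ 2 / 2)) < 1 := by
    rw [Real.exp_lt_one_iff]
    have : 0 < δ ^ 2 / 2 := by positivity
    linarith
  set q := Real.exp (-(δ ^ 2 / 2)) with hqd
  have hq0 : 0 < q := Real.exp_pos _
  have e1 : Real.exp (δ ^ 2 / 2 - δ ^ 2) = q := by rw [hqd]; congr 1; ring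
  rw [e1]
  set E := Real.exp (δ * w - δ ^ 2 * T) with hE
  have hE0 : 0 < E := Real.exp_pos _
  have h1q : 0 < 1 - q := by linarith
  have h1 : (if T < K then (1 : ENNReal) else 0) + ((K - (T + 1) : ℕ) : ENNReal)
      ≤ ((K - T : ℕ) : ENNReal) := by
    split_ifs with h
    · have : K - T = 1 + (K - (T + 1)) := by omega
      rw [this]; push_cast; exact le_rfl
    · rw [zero_add]
      exact_mod_cast Nat.sub_le_sub_left (Nat.le_succ T) K
  have h2 : (if T * δ ≤ w then (1 : ENNReal) else 0)
      + ENNReal.ofReal (1 / (1 - q)) * (ENNReal.ofReal q * ENNReal.ofReal E)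
      ≤ ENNReal.ofReal (1 / (1 - q)) * ENNReal.ofReal E := by
    rw [← ENNReal.ofReal_mul hq0.le, ← ENNReal.ofReal_mul (by positivity),
      ← ENNReal.ofReal_mul (by positivity)]
    split_ifs with h
    · rw [← ENNReal.ofReal_one, ← ENNReal.ofReal_add (by norm_num) (by positivity)]
      apply ENNReal.ofReal_le_ofReal
      have hE1 : 1 ≤ E := Real.one_le_exp (by nlinarith)
      have e2 : 1 / (1 - q) * E - 1 / (1 - q) * (q * E) = E := by field_simp
      linarith
    · rw [zero_add]
      apply ENNReal.ofReal_le_ofReal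
      gcongr
      nlinarith
  unfold playCost
  calc _ = ((if T < K then (1 : ENNReal) else 0) + ((K - (T + 1) : ℕ) : ENNReal))
        + ((if T * δ ≤ w then (1 : ENNReal) else 0)
      + ENNReal.ofReal (1 / (1 - q)) * (ENNReal.ofReal q * ENNReal.ofReal E)) := by
        rw [add_add_add_comm]
    _ ≤ _ := add_le_add h1 h2

lemma playPotential_zero_le {δ : ℝ} (hδ : 0 < δ) (K : ℕ) :
    playPotential K δ 0 0 ≤ ENNReal.ofReal (K + (1 + 2 / δ ^ 2)) := by
  have hc : 0 < δ ^ 2 / 2 := by positivity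
  unfold playPotential
  have h3 : 0 < 1 - Real.exp (-(δ ^ 2 / 2)) := by
    have : Real.exp (-(δ ^ 2 / 2)) < 1 := by rw [Real.exp_lt_one_iff]; linarith
    linarith
  have h4 : Real.exp (-(δ ^ 2 / 2)) * (1 + δ ^ 2 / 2) ≤ 1 := by
    rw [Real.exp_neg, inv_mul_le_one₀ (Real.exp_pos _)]
    linarith [Real.add_one_le_exp (δ ^ 2 / 2)]
  have h5 : 1 / (1 - Real.exp (-(δ ^ 2 / 2))) ≤ 1 + 2 / δ ^ 2 := by
    rw [div_le_iff₀ h3]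
    have e : 2 / δ ^ 2 = 1 / (δ ^ 2 / 2) := by field_simp
    have e2 : 1 + 1 / (δ ^ 2 / 2) = (1 + δ ^ 2 / 2) / (δ ^ 2 / 2) := by field_simp; ring
    rw [e, e2, div_mul_eq_mul_div, le_div_iff₀ hc]
    linarith
  simp only [Nat.sub_zero, mul_zero, Nat.cast_zero, sub_zero, Real.exp_zero, ENNReal.ofReal_one,
    mul_one]
  rw [ENNReal.ofReal_add (by positivity) (by positivity), ENNReal.ofReal_natCast]
  exact add_le_add le_rfl (ENNReal.ofReal_le_ofReal h5)

/-- If a suboptimal arm has the largest index, then the index of the optimal arm is small or the arm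
incurs a cost. -/
lemma index_dichotomy {n t : ℕ} {ω : Ω} {i j : Fin d} {Δ : ℝ} (ht : t < n)
    (hΔ : 0 < Δ) (hμ : μ j = μ i + Δ) (hlog : 1 ≤ Real.log n)
    (hi : 1 ≤ armCount I i t ω)
    (hidx : flatIndex n I X j t ω ≤ flatIndex n I X i t ω)
    (hj : ¬ flatIndex n I X j t ω < μ j - Δ / 2) :
    1 ≤ playCost ⌈96 * Real.log n / Δ ^ 2⌉₊ (Δ / 4) (armCount I i t ω) (armWalk 1 μ I X i t ω) := by
  set T := armCount I i t ω with hT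
  unfold playCost
  rcases lt_or_ge T ⌈96 * Real.log n / Δ ^ 2⌉₊ with hlt | hge
  · rw [if_pos hlt]; exact le_self_add
  refine le_trans ?_ le_add_self
  rw [if_pos]
  have hT0 : (0 : ℝ) < T := by exact_mod_cast hi
  have hn : (0 : ℝ) < n := by
    have : 0 < n := by omega
    exact_mod_cast this
  have hTge : 96 * Real.log n / Δ ^ 2 ≤ T := (Nat.le_ceil _).trans (by exact_mod_cast hge)
  -- Both requirements of `gittinsIndex_le` hold: `x ≥ 1` and `x ^ 2 / 2 ≥ log n`. Since `log n ≥
  -- 1`, also `x ^ 2 ≤ 6 * log n`, and `96 = 6 * 4 ^ 2` makes `x / √T` at most `Δ / 4`.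
  set x := √(2 * Real.log n) + 1 with hx
  have hs0 : 0 ≤ √(2 * Real.log n) := Real.sqrt_nonneg _
  have hs2 : √(2 * Real.log n) ^ 2 = 2 * Real.log n := Real.sq_sqrt (by linarith)
  have hs : 0 < √(T : ℝ) := Real.sqrt_pos.2 hT0
  have hsT : √(T : ℝ) ^ 2 = T := Real.sq_sqrt hT0.le
  have hm : ((n - t : ℕ) : ℝ) ≤ Real.exp (x ^ 2 / 2) := by
    calc ((n - t : ℕ) : ℝ) ≤ n := by exact_mod_cast Nat.sub_le n t
      _ = Real.exp (Real.log n) := (Real.exp_log hn).symm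
      _ ≤ _ := Real.exp_le_exp.2 (by nlinarith)
  have hup : flatIndex n I X i t ω ≤ empMean I X i t ω + 1 / √T * x := by
    refine gittinsIndex_le (by omega) (by positivity) ?_ (by linarith) hm
    rw [div_pow, hsT]; simp [hT]
  have hsmall : 1 / √T * x ≤ Δ / 4 := by
    rw [one_div_mul_eq_div, div_le_iff₀ hs]
    have h1 : x ^ 2 ≤ 6 * Real.log n := by
      nlinarith [sq_nonneg (√(2 * Real.log n) - 1)]
    have h2 : 96 * Real.log n ≤ T * Δ ^ 2 := by
      rwa [div_le_iff₀ (by positivity)] at hTge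
    apply le_of_sq_le_sq _ (by positivity)
    rw [mul_pow, hsT]
    nlinarith
  rw [armWalk_eq 1 μ I X i t ω hi, one_mul]
  apply mul_le_mul_of_nonneg_left _ hT0.le
  push Not at hj
  linarith

lemma sum_inv_sub_le {d n : ℕ} :
    ∑ t ∈ Finset.Ico d n, (1 : ℝ) / ((n - t : ℕ) : ℝ) ≤ 1 + Real.log n := by
  have h1 : ∑ t ∈ Finset.Ico d n, (1 : ℝ) / ((n - t : ℕ) : ℝ)
      ≤ ∑ t ∈ Finset.range n, (1 : ℝ) / ((n - t : ℕ) : ℝ) := by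
    refine Finset.sum_le_sum_of_subset_of_nonneg (fun t ht => ?_) fun _ _ _ => by positivity
    exact Finset.mem_range.2 (Finset.mem_Ico.1 ht).2
  refine h1.trans ?_
  have h2 : ∑ t ∈ Finset.range n, (1 : ℝ) / ((n - t : ℕ) : ℝ) = (harmonic n : ℝ) := by
    rw [← Finset.sum_range_reflect, harmonic]
    push_cast
    refine Finset.sum_congr rfl fun t ht => ?_
    have := Finset.mem_range.1 ht
    have e : n - (n - 1 - t) = t + 1 := by omega
    rw [e]; push_cast; rw [one_div]
  rw [h2]
  exact harmonic_le_one_add_log n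

variable [MeasurableSpace Ω] {P : Measure Ω}

/-- The expected number of plays of an arm. -/
def expectedPlays (P : Measure Ω) (n : ℕ) (I : ℕ → Ω → Fin d) (i : Fin d) : ℝ :=
  ∑ t ∈ Finset.range n, P.real {ω | I t ω = i}

variable [IsProbabilityMeasure P]

/-- The plays of an arm in the first `d` rounds. -/
lemma sum_initial_plays_le (hF : FollowsFlatGittins P n I X) (i : Fin d) :
    ∑ t ∈ (Finset.range n).filter (· < d), P {ω | I t ω = i} ≤ 1 := by
  have h : ∀ t ∈ (Finset.range n).filter (· < d), P {ω | I t ω = i}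
      ≤ if t = (i : ℕ) then 1 else 0 := by
    intro t ht
    obtain ⟨h1, h2⟩ := Finset.mem_filter.1 ht
    split_ifs with h3
    · exact prob_le_one
    · refine le_of_eq (measure_mono_null_ae ?_ (measure_empty (μ := P)))
      filter_upwards [hF] with ω hω hI
      have h4 := (hω t (Finset.mem_range.1 h1)).1 h2
      have h5 : I t ω = i := hI
      exact h3 (by rw [← h4, h5])
  refine (Finset.sum_le_sum h).trans ?_
  rw [Finset.sum_ite_eq']
  split_ifs <;> simp

/-- The plays of a suboptimal arm after the first `d` rounds. -/
lemma sum_later_plays_le {C : ℝ} (hC0 : 0 < C)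
    (hC : ∀ (m : ℕ) (ε : ℝ), 1 ≤ m → 0 < ε →
      ∃ V : ℕ → ℝ → ENNReal, IsSuperharmonic V ∧ V 0 0 ≤ ENNReal.ofReal (C / (m * ε ^ 2)) ∧
        ∀ (μ : ℝ) (T : ℕ) (w : ℝ), 1 ≤ T →
          gittinsIndex (μ - w / T) (T : ℝ≥0)⁻¹ m < μ - ε → 1 ≤ V T w)
    (h : IsInteraction P μ n I X) (hF : FollowsFlatGittins P n I X) {i j : Fin d} {Δ : ℝ}
    (hΔ : 0 < Δ) (hμ : μ j = μ i + Δ) (hlog : 1 ≤ Real.log n) :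
    ∑ t ∈ Finset.Ico d n, P {ω | I t ω = i}
      ≤ ENNReal.ofReal (2 + (8 * C + 128) * Real.log n / Δ ^ 2) := by
  set K := ⌈96 * Real.log n / Δ ^ 2⌉₊ with hK
  set cost : ℕ → Ω → ENNReal := fun t => {ω | I t ω = i}.indicator
    (fun ω => playCost K (Δ / 4) (armCount I i t ω) (armWalk 1 μ I X i t ω)) with hcost
  have hround : ∀ t ∈ Finset.Ico d n, P {ω | I t ω = i}
      ≤ ENNReal.ofReal (4 * C / Δ ^ 2 * (1 / ((n - t : ℕ) : ℝ))) + ∫⁻ ω, cost t ω ∂P := by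
    intro t ht
    obtain ⟨htd, htn⟩ := Finset.mem_Ico.1 ht
    -- Each round has its own potential, fitted to the `n - t` rounds that remain; it is run from
    -- the beginning and evaluated at time `t` only.
    obtain ⟨V, hV, hV0, hV1⟩ := hC (n - t) (Δ / 2) (by omega) (by positivity)
    have hle := h.lintegral_superharmonic_le j (e := -1) (by norm_num) hV htn.le
    have hVm : Measurable fun ω => V (armCount I j t ω) (armWalk (-1) μ I X j t ω) :=
      measurable_comp_nat_real hV.measurable (h.measurable_armCount j t)
        (h.measurable_armWalk (-1) j t)
    have hpt : ∀ᵐ ω ∂P, {ω | I t ω = i}.indicator (1 : Ω → ENNReal) ω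
        ≤ V (armCount I j t ω) (armWalk (-1) μ I X j t ω) + cost t ω := by
      filter_upwards [hF] with ω hω
      by_cases hi : I t ω = i
      · have hmem : ω ∈ {ω | I t ω = i} := hi
        have hcnt := one_le_armCount (I := I) (ω := ω) htd
          (fun s hs => (hω s (by omega)).1 hs)
        rw [Set.indicator_of_mem hmem]
        simp only [hcost, Set.indicator_of_mem hmem, Pi.one_apply]
        by_cases hj : flatIndex n I X j t ω < μ j - Δ / 2
        · refine le_trans (hV1 (μ j) _ _ (hcnt j) ?_) le_self_add
          have e : μ j - armWalk (-1) μ I X j t ω / armCount I j t ω = empMean I X j t ω := by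
            have h0 : (armCount I j t ω : ℝ) ≠ 0 := by
              have := hcnt j
              positivity
            rw [armWalk_eq _ μ I X j t ω (hcnt j), mul_div_cancel_left₀ _ h0]
            ring
          rw [e]
          exact hj
        · have hidx := (hω t htn).2 htd j
          rw [hi] at hidx
          exact (index_dichotomy htn hΔ hμ hlog (hcnt i) hidx hj).trans le_add_self
      · rw [Set.indicator_of_notMem (show ω ∉ {ω | I t ω = i} from hi)]
        exact zero_le
    have hint := lintegral_mono_ae hpt
    rw [lintegral_indicator_one (s := {ω | I t ω = i})
      (h.measurable_arm t (measurableSet_singleton i)),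
      lintegral_add_left hVm] at hint
    refine hint.trans (add_le_add ((hle.trans hV0).trans (le_of_eq ?_)) le_rfl)
    congr 1
    have : (0 : ℝ) < ((n - t : ℕ) : ℝ) := by
      have : 0 < n - t := by omega
      exact_mod_cast this
    field_simp; norm_num
  have hcosts : ∑ t ∈ Finset.Ico d n, ∫⁻ ω, cost t ω ∂P
      ≤ ENNReal.ofReal (K + (1 + 2 / (Δ / 4) ^ 2)) := by
    have h1 := h.sum_lintegral_cost_le i (e := 1) (by norm_num)
      (measurable_playPotential K (Δ / 4)) (measurable_playCost K (Δ / 4))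
      (playPotential_step (by positivity) K) le_rfl
    have h2 : ∑ t ∈ Finset.Ico d n, ∫⁻ ω, cost t ω ∂P
        ≤ ∑ t ∈ Finset.range n, ∫⁻ ω, cost t ω ∂P := by
      refine Finset.sum_le_sum_of_subset fun t ht => ?_
      exact Finset.mem_range.2 (Finset.mem_Ico.1 ht).2
    exact h2.trans (le_self_add.trans (h1.trans (playPotential_zero_le (by positivity) K)))
  refine (Finset.sum_le_sum hround).trans ?_
  rw [Finset.sum_add_distrib, ← ENNReal.ofReal_sum_of_nonneg (fun t _ => by positivity),
    ← Finset.mul_sum]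
  refine (add_le_add le_rfl hcosts).trans ?_
  rw [← ENNReal.ofReal_add (mul_nonneg (by positivity) (Finset.sum_nonneg fun t _ => by positivity))
    (by positivity)]
  apply ENNReal.ofReal_le_ofReal
  have hKle : (K : ℝ) ≤ 96 * Real.log n / Δ ^ 2 + 1 := (Nat.ceil_lt_add_one (by positivity)).le
  have hsum : 4 * C / Δ ^ 2 * ∑ t ∈ Finset.Ico d n, 1 / ((n - t : ℕ) : ℝ)
      ≤ 4 * C / Δ ^ 2 * (2 * Real.log n) := by
    gcongr
    have := sum_inv_sub_le (d := d) (n := n)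
    linarith
  have e1 : 2 / (Δ / 4) ^ 2 = 32 / Δ ^ 2 := by field_simp; norm_num
  have e2 : 32 / Δ ^ 2 ≤ 32 * Real.log n / Δ ^ 2 := by gcongr; linarith
  rw [e1]
  have e3 : (8 * C + 128) * Real.log n / Δ ^ 2 = 4 * C / Δ ^ 2 * (2 * Real.log n)
      + 96 * Real.log n / Δ ^ 2 + 32 * Real.log n / Δ ^ 2 := by ring
  linarith

/-- The expected number of plays of a suboptimal arm is at most logarithmic. -/
theorem exists_expectedPlays_le :
    ∃ C : ℝ, 3 ≤ C ∧ ∀ (d n : ℕ) (μ : Fin d → ℝ) (Ω : Type*) [MeasurableSpace Ω] (P : Measure Ω)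
      [IsProbabilityMeasure P] (I : ℕ → Ω → Fin d) (X : ℕ → Ω → ℝ),
      IsInteraction P μ n I X → FollowsFlatGittins P n I X → ∀ i, 0 < gap μ i →
        gap μ i * expectedPlays P n I i ≤ C * (Real.log n / gap μ i + gap μ i) := by
  obtain ⟨C, hC0, hC⟩ := exists_superharmonic_index
  refine ⟨8 * C + 128, by linarith, fun d n μ Ω _ P _ I X h hF i hi => ?_⟩
  set Δ := gap μ i with hΔ
  have hlog0 : 0 ≤ Real.log n := Real.log_natCast_nonneg n
  have hplays : expectedPlays P n I i ≤ 3 + (8 * C + 128) * Real.log n / Δ ^ 2 := by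
    have hsplit : ∑ t ∈ Finset.range n, P {ω | I t ω = i}
        ≤ ENNReal.ofReal (3 + (8 * C + 128) * Real.log n / Δ ^ 2) := by
      have hinit := sum_initial_plays_le hF i
      have hpart : ∑ t ∈ Finset.range n, P {ω | I t ω = i}
          = ∑ t ∈ (Finset.range n).filter (· < d), P {ω | I t ω = i}
            + ∑ t ∈ Finset.Ico d n, P {ω | I t ω = i} := by
        rw [← Finset.sum_filter_add_sum_filter_not (Finset.range n) (· < d)]
        congr 2
        ext t; simp; omega
      rw [hpart]
      have hlater : ∑ t ∈ Finset.Ico d n, P {ω | I t ω = i}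
          ≤ ENNReal.ofReal (2 + (8 * C + 128) * Real.log n / Δ ^ 2) := by
        -- If there are later rounds, then `n > d ≥ 2`, because a suboptimal arm differs from an
        -- optimal one; hence `n ≥ 3` and `log n ≥ 1`.
        rcases le_or_gt n d with hnd | hnd
        · rw [Finset.Ico_eq_empty (by omega), Finset.sum_empty]; exact zero_le
        have : Nonempty (Fin d) := ⟨i⟩
        obtain ⟨j, hj⟩ := exists_eq_ciSup_of_finite (f := μ)
        have hμ : μ j = μ i + Δ := by
          rw [hj, hΔ, gap, optMean]; ring
        have hne : i ≠ j := by
          rintro rfl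
          linarith
        have hd : 2 ≤ d := by
          have h1 := i.isLt
          have h2 := j.isLt
          have h3 : (i : ℕ) ≠ j := fun h => hne (Fin.ext h)
          omega
        have hn3 : (3 : ℝ) ≤ n := by
          have : 3 ≤ n := by omega
          exact_mod_cast this
        have hlog : 1 ≤ Real.log n := by
          rw [Real.le_log_iff_exp_le (by linarith)]
          linarith [Real.exp_one_lt_d9]
        exact sum_later_plays_le hC0 hC h hF hi hμ hlog
      refine (add_le_add hinit hlater).trans (le_of_eq ?_)
      rw [← ENNReal.ofReal_one, ← ENNReal.ofReal_add (by norm_num) (by positivity)]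
      congr 1; ring
    have := ENNReal.toReal_le_of_le_ofReal (by positivity) hsplit
    rw [ENNReal.toReal_sum fun t _ => measure_ne_top P _] at this
    exact this
  calc Δ * expectedPlays P n I i ≤ Δ * (3 + (8 * C + 128) * Real.log n / Δ ^ 2) := by gcongr
    _ = 3 * Δ + (8 * C + 128) * (Real.log n / Δ) := by field_simp
    _ ≤ _ := by nlinarith

/-! ### The regret -/

lemma regret_eq_sum (h : IsInteraction P μ n I X) :
    regret P μ n I = ∑ i, gap μ i * expectedPlays P n I i := by
  have hpt : ∀ ω, ∑ t ∈ Finset.range n, (optMean μ - μ (I t ω))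
      = ∑ i, ∑ t ∈ Finset.range n, gap μ i * {ω | I t ω = i}.indicator (1 : Ω → ℝ) ω := by
    intro ω
    rw [Finset.sum_comm]
    refine Finset.sum_congr rfl fun t _ => ?_
    rw [Finset.sum_eq_single (I t ω)]
    · simp [gap]
    · intro i _ hi
      rw [Set.indicator_of_notMem (show ω ∉ {ω | I t ω = i} from fun h' => hi h'.symm), mul_zero]
    · simp
  have hm : ∀ t i, MeasurableSet {ω | I t ω = i} := fun t i =>
    h.measurable_arm t (measurableSet_singleton i)
  have hint : ∀ t i, Integrable (fun ω => gap μ i * {ω | I t ω = i}.indicator (1 : Ω → ℝ) ω) P :=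
    fun t i => ((integrable_const (1 : ℝ)).indicator (hm t i)).const_mul _
  unfold regret
  simp_rw [hpt]
  rw [integral_finsetSum _ fun i _ => integrable_finsetSum _ fun t _ => hint t i]
  refine Finset.sum_congr rfl fun i _ => ?_
  rw [integral_finsetSum _ fun t _ => hint t i, expectedPlays, Finset.mul_sum]
  refine Finset.sum_congr rfl fun t _ => ?_
  rw [integral_const_mul, integral_indicator_one (hm t i)]

lemma sum_expectedPlays (h : IsInteraction P μ n I X) : ∑ i, expectedPlays P n I i = n := by
  unfold expectedPlays
  rw [Finset.sum_comm]
  have : ∀ t ∈ Finset.range n, ∑ i, P.real {ω | I t ω = i} = 1 := by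
    intro t _
    have h1 := sum_measureReal_preimage_singleton (μ := P) (f := I t) (Finset.univ : Finset (Fin d))
      (fun i _ => h.measurable_arm t (measurableSet_singleton i))
    simpa [Set.preimage] using h1
  rw [Finset.sum_congr rfl this]; simp

end Plays

end GittinsBandit

end

/-- For the second bound, arms with gap at most `δ` cost at most `δ * n` together, as all plays add
up to `n`, and each other arm costs at most `C * (log n / δ + gap)`. The choice `δ = √(d * n * log
n) / n` makes both `δ * n` and `d * (log n / δ)` equal to `√(d * n * log n)`. -/
theorem theorem2 :
    ∃ c c' : ℝ, 0 < c ∧ 0 < c' ∧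
      ∀ (d n : ℕ) (μ : Fin d → ℝ) (Ω : Type*) [MeasurableSpace Ω] (P : Measure Ω)
        [IsProbabilityMeasure P] (I : ℕ → Ω → Fin d) (X : ℕ → Ω → ℝ),
        GittinsBandit.IsInteraction P μ n I X →
        GittinsBandit.FollowsFlatGittins P n I X →
        GittinsBandit.regret P μ n I ≤
            c * ∑ i with 0 < GittinsBandit.gap μ i,
              (Real.log n / GittinsBandit.gap μ i + GittinsBandit.gap μ i) ∧
          GittinsBandit.regret P μ n I ≤
            c' * (√(d * n * Real.log n) + ∑ i, GittinsBandit.gap μ i) := by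
  obtain ⟨C, hC3, hC⟩ := GittinsBandit.exists_expectedPlays_le
  refine ⟨C, C + 1, by linarith, by linarith, fun d n μ Ω _ P _ I X h hF => ?_⟩
  have hplays := hC d n μ Ω P I X h hF
  have hgap := GittinsBandit.gap_nonneg μ
  have hlog0 : 0 ≤ Real.log n := Real.log_natCast_nonneg n
  have hfirst : GittinsBandit.regret P μ n I ≤ C * ∑ i with 0 < GittinsBandit.gap μ i,
      (Real.log n / GittinsBandit.gap μ i + GittinsBandit.gap μ i) := by
    rw [GittinsBandit.regret_eq_sum h, Finset.mul_sum, Finset.sum_filter]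
    refine Finset.sum_le_sum fun i _ => ?_
    split_ifs with hi
    · exact hplays i hi
    · rw [le_antisymm (not_lt.1 hi) (hgap i), zero_mul]
  refine ⟨hfirst, ?_⟩
  have hsum0 : 0 ≤ ∑ i, GittinsBandit.gap μ i := Finset.sum_nonneg fun i _ => hgap i
  have hnn : 0 ≤ (d : ℝ) * n * Real.log n := by positivity
  set s := √(d * n * Real.log n) with hs
  have hs2 : s ^ 2 = d * n * Real.log n := Real.sq_sqrt hnn
  -- If the root vanishes, `δ` would be `0`. But then either there are no arms or `log n = 0` (for
  -- `n = 0` by the convention `log 0 = 0`), and the first bound suffices.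
  rcases (Real.sqrt_nonneg (d * n * Real.log n)).eq_or_lt with hs0 | hs0
  · rw [← hs] at hs0
    rw [← hs0, zero_add]
    refine hfirst.trans ?_
    have hz : ∀ i : Fin d, Real.log n = 0 := by
      intro i
      rw [← hs0] at hs2
      have hd : (d : ℝ) ≠ 0 := by
        have := i.pos
        positivity
      rcases mul_eq_zero.1 (by linarith : (d : ℝ) * n * Real.log n = 0) with h1 | h1
      · rcases mul_eq_zero.1 h1 with h2 | h2
        · exact absurd h2 hd
        · rw [h2, Real.log_zero]
      · exact h1
    have hle : ∑ i with 0 < GittinsBandit.gap μ i,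
        (Real.log n / GittinsBandit.gap μ i + GittinsBandit.gap μ i)
        ≤ ∑ i, GittinsBandit.gap μ i := by
      rw [Finset.sum_filter]
      refine Finset.sum_le_sum fun i _ => ?_
      split_ifs
      · rw [hz i, zero_div, zero_add]
      · exact hgap i
    nlinarith
  · rw [← hs] at hs0
    have hn0 : (0 : ℝ) < n := by
      rcases Nat.eq_zero_or_pos n with h0 | h0
      · rw [h0] at hs2; simp at hs2; exact absurd hs2 hs0.ne'
      · exact_mod_cast h0
    set δ := s / n with hδ
    have hδ0 : 0 < δ := by positivity
    have harm : ∀ i, GittinsBandit.gap μ i * GittinsBandit.expectedPlays P n I i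
        ≤ δ * GittinsBandit.expectedPlays P n I i
          + C * (Real.log n / δ + GittinsBandit.gap μ i) := by
      intro i
      have he : 0 ≤ GittinsBandit.expectedPlays P n I i :=
        Finset.sum_nonneg fun t _ => measureReal_nonneg
      have hg := hgap i
      rcases le_or_gt (GittinsBandit.gap μ i) δ with hi | hi
      · have h1 : GittinsBandit.gap μ i * GittinsBandit.expectedPlays P n I i
            ≤ δ * GittinsBandit.expectedPlays P n I i := mul_le_mul_of_nonneg_right hi he
        have h2 : 0 ≤ C * (Real.log n / δ + GittinsBandit.gap μ i) :=
          mul_nonneg (by linarith) (by positivity)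
        linarith
      · have h1 := hplays i (hδ0.trans hi)
        have h2 : Real.log n / GittinsBandit.gap μ i ≤ Real.log n / δ := by gcongr
        have h3 : 0 ≤ δ * GittinsBandit.expectedPlays P n I i := by positivity
        nlinarith
    rw [GittinsBandit.regret_eq_sum h]
    refine (Finset.sum_le_sum fun i _ => harm i).trans ?_
    rw [Finset.sum_add_distrib, ← Finset.mul_sum, ← Finset.mul_sum, Finset.sum_add_distrib,
      GittinsBandit.sum_expectedPlays h, Finset.sum_const, Finset.card_univ, Fintype.card_fin,
      nsmul_eq_mul]
    have e1 : δ * n = s := by rw [hδ]; field_simp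
    have e2 : d * (Real.log n / δ) = s := by
      rw [hδ, div_div_eq_mul_div, ← mul_div_assoc, div_eq_iff hs0.ne', ← sq, hs2]; ring
    rw [e1, e2]
    nlinarith
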